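/- Let $X\subset\mathbb{R}^D$ be a set of $N\ge 2$ points with weights $w:X\to\mathbb{N}$, let $K\ge 1$, let $m>1$ be real (the fuzzifier) and let $\epsilon\in(0,1)$. For means $\mu_1,\dots,\mu_K\in\mathbb{R}^D$ and a membership function $r:X\times\{1,\dots,K\}\to[0,1]$ with $\sum_{k}r(x,k)=1$ for all $x\in X$, put \[ \phi(X,w,(\mu_k)_k,r)=\sum_{x\in X}w(x)\sum_{k=1}^{K}r(x,k)^m\,\|x-\mu_k\|^2 . \] For a finite set $M$ of means let $\phi(X,w,M)$ be the minimum of $\phi(X,w,M,r)$ over all membership functions $r$, and let $\phi^{opt}(X,w)$ be the minimum over all $K$ means and all membership functions. Let $n=\lceil 64K/\epsilon\rceil$ and let $\mathcal{T}$ be the set of the (unweighted) means $\frac1n\sum_{y\in S}y$ of all multisets $S$ of $n$ points of $X$. Consider the derandomized sampling algorithm that enumerates the means of all samples of $n$ points of $X$, enumerates all choices of $K$ different elements of $\mathcal{T}$, evaluates the cost $\phi(X,w,T)$ of each such $T$ through the explicit optimal memberships, and returns the best one. Its running time is counted on a unit-cost real RAM (arithmetic operations and comparisons of real numbers, real powers,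 and elementary bookkeeping steps cost one step each). Theorem. The algorithm returns a set $M\subseteq\mathcal{T}$ with $|M|=K$ that minimizes $\phi(X,w,T)$ over all $T\subseteq\mathcal{T}$ with $|T|=K$, and \[ \phi(X,w,M)\le(1+\epsilon)\,\phi^{opt}(X,w) . \] Its running time is at most $D\cdot N^{C K^2/\epsilon}$, where $C$ is a universal constant, and the number of steps does not depend on the weights $w$. -/

import Mathlib

/-! ### Weighted fuzzy `K`-means

The data set is an array `x : Fin N → EuclideanSpace ℝ (Fin D)` (injective in the theorem, so
that it lists a set of `N` points) with weights `w : Fin N → ℕ`. Means are families indexed by a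
finite type `ι`; a finite set of means is the family of its own elements. -/

namespace FuzzyKMeans

/-- `r i k ∈ [0,1]` is the degree to which the point `i` belongs to the cluster `k`; the degrees
of each point sum to one. -/
def IsMembership {N : ℕ} {ι : Type*} [Fintype ι] (r : Fin N → ι → ℝ) : Prop :=
  (∀ i k, 0 ≤ r i k ∧ r i k ≤ 1) ∧ ∀ i, ∑ k, r i k = 1

/-- The objective `φ(X, w, μ, r)` with fuzzifier `m`. -/
noncomputable def cost {D N : ℕ} {ι : Type*} [Fintype ι]
    (x : Fin N → EuclideanSpace ℝ (Fin D)) (w : Fin N → ℕ) (m : ℝ)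
    (μ : ι → EuclideanSpace ℝ (Fin D)) (r : Fin N → ι → ℝ) : ℝ :=
  ∑ i, (w i : ℝ) * ∑ k, r i k ^ m * ‖x i - μ k‖ ^ 2

/-- `φ(X, w, M)`: the cost of a finite set `M` of means under optimal memberships. For `M ≠ ∅`
the set below is nonempty and bounded below by `0`. -/
noncomputable def setCost {D N : ℕ}
    (x : Fin N → EuclideanSpace ℝ (Fin D)) (w : Fin N → ℕ) (m : ℝ)
    (M : Finset (EuclideanSpace ℝ (Fin D))) : ℝ :=
  sInf {c : ℝ | ∃ r : Fin N → M → ℝ, IsMembership r ∧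
    c = cost x w m (fun v : M => (v : EuclideanSpace ℝ (Fin D))) r}

/-- `φ^opt(X, w)`: the optimal cost over all means `μ₁, …, μ_K` (repetitions are allowed) and all
membership functions. For `1 ≤ K` the set below is nonempty and bounded below by `0`. -/
noncomputable def optCost {D N : ℕ}
    (x : Fin N → EuclideanSpace ℝ (Fin D)) (w : Fin N → ℕ) (m : ℝ) (K : ℕ) : ℝ :=
  sInf {c : ℝ | ∃ (μ : Fin K → EuclideanSpace ℝ (Fin D)) (r : Fin N → Fin K → ℝ),
    IsMembership r ∧ c = cost x w m μ r}

/-- The unweighted means of all multisets of `n` points of the data set. -/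
def candidates {D N : ℕ} (x : Fin N → EuclideanSpace ℝ (Fin D)) (n : ℕ) :
    Set (EuclideanSpace ℝ (Fin D)) :=
  {v | ∃ S : Multiset (EuclideanSpace ℝ (Fin D)),
    (∀ y ∈ S, y ∈ Set.range x) ∧ Multiset.card S = n ∧ v = (n : ℝ)⁻¹ • S.sum}

/-! ### Step-counted computations

A unit-cost real RAM: reading a cell, one arithmetic operation on real numbers (`+`, `-`, `*`,
`/` and real powers), one comparison, one list cell, one Boolean operation, and the overhead of
one loop iteration cost one step each. -/

/-- The result of a computation together with the number of elementary steps it took. -/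
structure Timed (α : Type) where
  val : α
  time : ℕ

instance : Monad Timed where
  pure a := ⟨a, 0⟩
  bind t f := ⟨(f t.val).val, t.time + (f t.val).time⟩

/-- One elementary step with result `a`. -/
def op {α : Type} (a : α) : Timed α := ⟨a, 1⟩

/-- Run through a list, updating a state; each iteration has an overhead of one step. -/
def loop {α β : Type} (body : β → α → Timed β) : β → List α → Timed β
  | b, [] => op b
  | b, a :: l => do
      let b₁ ← body b a
      let b₂ ← op b₁
      loop body b₂ l

/-- All sequences of length `k` with entries in `l`. -/
def sequences {α : Type} (l : List α) : ℕ → Timed (List (List α))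
  | 0 => op [[]]
  | k + 1 => do
      let R ← sequences l k
      loop (fun acc a => loop (fun acc t => do
        let s ← op (a :: t)
        op (s :: acc)) acc R) [] l

/-- Allocate a vector and fill its coordinates one after the other. -/
noncomputable def tabulate {D : ℕ} (f : Fin D → Timed ℝ) :
    Timed (EuclideanSpace ℝ (Fin D)) :=
  ⟨WithLp.toLp 2 (fun i => (f i).val), 1 + ∑ i, ((f i).time + 1)⟩

/-- The mean of the `n` data points whose indices are listed in `S`. -/
noncomputable def sampleMean {D N : ℕ} (x : Fin N → EuclideanSpace ℝ (Fin D)) (n : ℕ)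
    (S : List (Fin N)) : Timed (EuclideanSpace ℝ (Fin D)) :=
  tabulate fun i => do
    let s ← loop (fun acc j => do
      let y ← op (x j i)
      op (acc + y)) (0 : ℝ) S
    op (s / (n : ℝ))

/-- The squared Euclidean distance. -/
noncomputable def sqDist {D : ℕ} (p q : EuclideanSpace ℝ (Fin D)) : Timed ℝ :=
  loop (fun acc i => do
    let d ← op (p i - q i)
    let e ← op (d * d)
    op (acc + e)) 0 (List.finRange D)

/-- Is the point `v` different from all points of the list? -/
noncomputable def notIn {D : ℕ} (v : EuclideanSpace ℝ (Fin D))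
    (l : List (EuclideanSpace ℝ (Fin D))) : Timed Bool :=
  loop (fun b u => do
    let d ← sqDist v u
    let c ← op (decide (d ≠ 0))
    op (b && c)) true l

/-- Are the points of the list pairwise different? -/
noncomputable def distinct {D : ℕ} : List (EuclideanSpace ℝ (Fin D)) → Timed Bool
  | [] => op true
  | v :: l => do
      let b ← notIn v l
      let c ← distinct l
      op (b && c)

/-- The cost of one point `y` of weight one with respect to the means in `l` under optimal
memberships: `0` if `y` is one of the means, and
`(∑ v ∈ l, (‖y - v‖ ^ 2) ^ (1 / (1 - m))) ^ (1 - m)` otherwise. -/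
noncomputable def pointCost {D : ℕ} (m : ℝ) (l : List (EuclideanSpace ℝ (Fin D)))
    (y : EuclideanSpace ℝ (Fin D)) : Timed ℝ := do
  let a ← op (1 - m)
  let b ← op (1 / a)
  let st ← loop (fun (st : ℝ × Bool) v => do
    let d ← sqDist y v
    let z ← op (decide (d = 0))
    if z then op (st.1, true)
    else do
      let p ← op (d ^ b)
      let s ← op (st.1 + p)
      op (s, st.2)) (0, false) l
  if st.2 then op 0 else op (st.1 ^ a)

/-- The weighted cost of the means in `l`. -/
noncomputable def evalCost {D N : ℕ} (x : Fin N → EuclideanSpace ℝ (Fin D)) (w : Fin N → ℕ)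
    (m : ℝ) (l : List (EuclideanSpace ℝ (Fin D))) : Timed ℝ :=
  loop (fun acc i => do
    let c ← pointCost m l (x i)
    let u ← op (w i : ℝ)
    let t ← op (u * c)
    op (acc + t)) 0 (List.finRange N)

/-- Keep the better one of the best solution so far and a new one of cost `c`. -/
noncomputable def keepBest {D : ℕ} (best : Option (List (EuclideanSpace ℝ (Fin D)) × ℝ))
    (l : List (EuclideanSpace ℝ (Fin D))) (c : ℝ) :
    Timed (Option (List (EuclideanSpace ℝ (Fin D)) × ℝ)) := do
  let b ← op (match best with
    | none => true
    | some q => decide (c < q.2))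
  op (if b then some (l, c) else best)

/-- The size `⌈64 K / ε⌉` of the sampled multisets. -/
noncomputable def sampleSize (K : ℕ) (ε : ℝ) : ℕ := ⌈64 * (K : ℝ) / ε⌉₊

/-- The sample size is found by counting upwards to the first `n` with `64 K ≤ n ε`: at most one
update, one comparison and one loop overhead for each of the values `0, …, n`. -/
noncomputable def computeSampleSize (K : ℕ) (ε : ℝ) : Timed ℕ :=
  ⟨sampleSize K ε, 3 * (sampleSize K ε + 1)⟩

/-- The derandomized sampling algorithm: enumerate the means of all samples of `⌈64 K / ε⌉` data
points, enumerate all choices of `K` different means among them, evaluate the cost of each, and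
return the best one (`none` if there are no `K` different means). -/
noncomputable def derandomizedSampling {D N : ℕ} (x : Fin N → EuclideanSpace ℝ (Fin D))
    (w : Fin N → ℕ) (m : ℝ) (K : ℕ) (ε : ℝ) :
    Timed (Option (List (EuclideanSpace ℝ (Fin D)))) := do
  let n ← computeSampleSize K ε
  let samples ← sequences (List.finRange N) n
  let means ← loop (fun acc S => do
    let v ← sampleMean x n S
    op (v :: acc)) [] samples
  let choices ← sequences means K
  let best ← loop (fun best l => do
    let ok ← distinct l
    if ok then do
      let c ← evalCost x w m l
      keepBest best l c
    else op best) none choices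
  op (best.map Prod.fst)

end FuzzyKMeans

namespace FuzzyKMeans

/-! ### Values of step-counted computations -/

/-! Fix means `μ k` and memberships `r`. With the cluster weights `a i = w i * r i k ^ m` the cost
splits into `K` independent weighted one-mean problems. The cost of cluster `k` at a mean `v` is its
cost `V` at the weighted centroid plus the total weight times the squared distance of `v` to the
centroid. Averaging over the choice of one point after another produces a sample whose mean is as
close to the centroid as that of a random sample (`exists_sample`).

The real difficulty is that the `K` means must be different, although several clusters may want the
same candidate. So each cluster is given at least `K` good candidates
(`exists_candidates_for_cluster`). If two data points lie within a moderate distance of the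
centroid, most of the sample is chosen by averaging and `K` places are filled with copies of these
two points in varying proportion. Otherwise one data point carries nearly all the weight and lies
very near the centroid. Then small shifts from it towards its nearest neighbour are good for every
point except that one, called `z`.

The point `z` costs nothing as soon as it is itself one of the means, whichever cluster that mean
represents. Hall's theorem supplies different representatives that also hit every `z`
(`exists_injective_hitting`), and `setCost_image_le` turns them into a bound on the total cost.

Hölder's inequality shows that the explicit formula evaluated by the algorithm is the minimum over
memberships, so exhaustive search finds the best choice of candidates. The running time is governed
by the number `N ^ (n * K)` of enumerated choices. -/

@[simp] theorem Timed.bind_val {α β : Type} (t : Timed α) (f : α → Timed β) :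
    (t >>= f).val = (f t.val).val := rfl

@[simp] theorem Timed.bind_time {α β : Type} (t : Timed α) (f : α → Timed β) :
    (t >>= f).time = t.time + (f t.val).time := rfl

@[simp] theorem op_val {α : Type} (a : α) : (op a).val = a := rfl

@[simp] theorem op_time {α : Type} (a : α) : (op a).time = 1 := rfl

theorem loop_val {α β : Type} (body : β → α → Timed β) (b : β) (l : List α) :
    (loop body b l).val = l.foldl (fun b a => (body b a).val) b := by
  induction l generalizing b with
  | nil => rfl
  | cons a l ih => simp [loop, ih]

/-- The duration of an iteration may depend on the list entry but not on the state. This is what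
later makes the step count independent of the weights, which influence only the state. -/
theorem loop_time_eq {α β : Type} {body : β → α → Timed β} {τ : α → ℕ} {l : List α}
    (h : ∀ b, ∀ a ∈ l, (body b a).time = τ a) (b : β) :
    (loop body b l).time = 1 + (l.map fun a => τ a + 1).sum := by
  induction l generalizing b with
  | nil => rfl
  | cons a l ih =>
    simp only [loop, Timed.bind_time, op_time, op_val, List.map_cons, List.sum_cons]
    rw [ih (fun b a ha => h b a (List.mem_cons_of_mem _ ha)), h b a List.mem_cons_self]
    omega

theorem loop_time_le {α β : Type} {body : β → α → Timed β} {t : ℕ} {l : List α}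
    (h : ∀ b, ∀ a ∈ l, (body b a).time ≤ t) (b : β) :
    (loop body b l).time ≤ 1 + l.length * (t + 1) := by
  induction l generalizing b with
  | nil => simp [loop]
  | cons a l ih =>
    simp only [loop, Timed.bind_time, op_time, op_val, List.length_cons]
    have h1 := ih (fun b a ha => h b a (List.mem_cons_of_mem _ ha)) (body b a).val
    have h2 := h b a List.mem_cons_self
    rw [add_mul]
    omega

theorem foldl_cons_eq {α β : Type} (f : α → β) (l : List α) (acc : List β) :
    l.foldl (fun acc a => f a :: acc) acc = (l.map f).reverse ++ acc := by
  induction l generalizing acc with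
  | nil => rfl
  | cons a l ih => simp [ih]

theorem sequences_succ_val {α : Type} (l : List α) (k : ℕ) :
    (sequences l (k + 1)).val =
      l.foldl (fun acc a => ((sequences l k).val.map (a :: ·)).reverse ++ acc) [] := by
  simp [sequences, loop_val]

theorem mem_foldl_append {α β : Type} (f : α → List β) (l : List α) (acc : List β) (b : β) :
    b ∈ l.foldl (fun acc a => f a ++ acc) acc ↔ b ∈ acc ∨ ∃ a ∈ l, b ∈ f a := by
  induction l generalizing acc with
  | nil => simp
  | cons a l ih =>
    simp only [List.foldl_cons, ih, List.mem_append, List.mem_cons, exists_eq_or_imp]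
    tauto

theorem length_foldl_append {α β : Type} {f : α → List β} {c : ℕ} (l : List α)
    (h : ∀ a ∈ l, (f a).length = c) (acc : List β) :
    (l.foldl (fun acc a => f a ++ acc) acc).length = acc.length + l.length * c := by
  induction l generalizing acc with
  | nil => simp
  | cons a l ih =>
    rw [List.foldl_cons, ih (fun a ha => h a (List.mem_cons_of_mem _ ha)), List.length_append,
      h a List.mem_cons_self, List.length_cons]
    ring

/-- The enumeration consists of the lists of length `k` with entries in `l`. -/
theorem mem_sequences {α : Type} (l : List α) (k : ℕ) (s : List α) :
    s ∈ (sequences l k).val ↔ s.length = k ∧ ∀ a ∈ s, a ∈ l := by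
  induction k generalizing s with
  | zero => cases s <;> simp [sequences]
  | succ k ih =>
    rw [sequences_succ_val, mem_foldl_append]
    cases s with
    | nil => simp
    | cons a s => simp [ih, and_left_comm]

theorem length_sequences {α : Type} (l : List α) (k : ℕ) :
    (sequences l k).val.length = l.length ^ k := by
  induction k with
  | zero => simp [sequences]
  | succ k ih =>
    rw [sequences_succ_val, length_foldl_append (c := l.length ^ k) l (by simp [ih])]
    simp [pow_succ, mul_comm]

theorem foldl_add_eq_sum {α : Type} (f : α → ℝ) (l : List α) (s : ℝ) :
    l.foldl (fun acc a => acc + f a) s = s + (l.map f).sum := by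
  induction l generalizing s with
  | nil => simp
  | cons a l ih => simp [ih, add_assoc]

theorem foldl_and_eq {α : Type} (f : α → Bool) (l : List α) (s : Bool) :
    l.foldl (fun b a => b && f a) s = (s && l.all f) := by
  induction l generalizing s with
  | nil => simp
  | cons a l ih => simp [ih, Bool.and_assoc]

theorem sampleMean_val {D N : ℕ} (x : Fin N → EuclideanSpace ℝ (Fin D)) (n : ℕ)
    (S : List (Fin N)) :
    (sampleMean x n S).val = (n : ℝ)⁻¹ • (S.map x).sum := by
  have h (i : Fin D) : ((S.map x).sum) i = (S.map fun j => x j i).sum := by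
    induction S with
    | nil => simp
    | cons a S ih => simp [ih]
  ext i
  simp [sampleMean, tabulate, loop_val, foldl_add_eq_sum, h, div_eq_inv_mul]

theorem sqDist_val {D : ℕ} (p q : EuclideanSpace ℝ (Fin D)) :
    (sqDist p q).val = ‖p - q‖ ^ 2 := by
  simp only [sqDist, loop_val, Timed.bind_val, op_val, foldl_add_eq_sum, EuclideanSpace.norm_sq_eq,
    ← Fin.sum_univ_def, Real.norm_eq_abs, sq_abs]
  simp [sq]

theorem notIn_val {D : ℕ} (v : EuclideanSpace ℝ (Fin D)) (l : List (EuclideanSpace ℝ (Fin D))) :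
    (notIn v l).val = true ↔ v ∉ l := by
  simp only [notIn, loop_val, Timed.bind_val, op_val, sqDist_val, foldl_and_eq]
  simp [sub_eq_zero]
  aesop

theorem distinct_val {D : ℕ} (l : List (EuclideanSpace ℝ (Fin D))) :
    (distinct l).val = true ↔ l.Nodup := by
  induction l with
  | nil => simp [distinct]
  | cons v l ih => simp [distinct, ih, notIn_val]

/-- The cost computed for one point, written as a sum over a list. -/
theorem pointCost_val {D : ℕ} (m : ℝ) (l : List (EuclideanSpace ℝ (Fin D)))
    (y : EuclideanSpace ℝ (Fin D)) :
    (pointCost m l y).val =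
      if y ∈ l then 0 else ((l.map fun v => (‖y - v‖ ^ 2) ^ (1 / (1 - m))).sum) ^ (1 - m) := by
  set f : ℝ × Bool → EuclideanSpace ℝ (Fin D) → ℝ × Bool := fun st v =>
    if y = v then (st.1, true) else (st.1 + (‖y - v‖ ^ 2) ^ (1 / (1 - m)), st.2) with hf
  -- Loop invariant for arbitrary initial accumulators: the flag records whether `y` has occurred,
  -- and the partial sum is specified only when it has not.
  have key (l : List (EuclideanSpace ℝ (Fin D))) (s : ℝ) (b : Bool) :
      ((l.foldl f (s, b)).2 = true ↔ b = true ∨ y ∈ l) ∧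
      (y ∉ l → (l.foldl f (s, b)).1 =
        s + (l.map fun v => (‖y - v‖ ^ 2) ^ (1 / (1 - m))).sum) := by
    induction l generalizing s b with
    | nil => simp
    | cons v l ih =>
      by_cases h : y = v
      · have h' : f (s, b) v = (s, true) := by simp [hf, h]
        rw [List.foldl_cons, h']
        simp [ih, h]
      · have h' : f (s, b) v = (s + (‖y - v‖ ^ 2) ^ (1 / (1 - m)), b) := by simp [hf, h]
        rw [List.foldl_cons, h']
        refine ⟨by simp [ih, h], fun hy => ?_⟩
        rw [(ih _ _).2 (by simp_all)]
        simp [add_assoc]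
  have hloop : ((pointCost m l y).val =
      if (l.foldl f (0, false)).2 then 0 else (l.foldl f (0, false)).1 ^ (1 - m)) := by
    have : f = fun st v => (do
        let d ← sqDist y v
        let z ← op (decide (d = 0))
        if z then op (st.1, true)
        else do
          let p ← op (d ^ (1 / (1 - m)))
          let s ← op (st.1 + p)
          op (s, st.2) : Timed (ℝ × Bool)).val := by
      funext st v
      by_cases h : y = v
      · simp [hf, h, sqDist_val]
      · simp [hf, h, sqDist_val, sub_eq_zero]
    rw [this]
    simp only [pointCost, Timed.bind_val, op_val, loop_val]
    exact apply_ite Timed.val _ _ _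
  have := key l 0 false
  rw [hloop]
  by_cases hy : y ∈ l
  · simp [this.1, hy]
  · simp [this.1, this.2 hy, hy]

theorem evalCost_val {D N : ℕ} (x : Fin N → EuclideanSpace ℝ (Fin D)) (w : Fin N → ℕ)
    (m : ℝ) (l : List (EuclideanSpace ℝ (Fin D))) :
    (evalCost x w m l).val = ∑ i, (w i : ℝ) * (pointCost m l (x i)).val := by
  simp [evalCost, loop_val, foldl_add_eq_sum, Fin.sum_univ_def]

/-- Scanning a list and keeping the admissible element of least cost. -/
theorem foldl_keepBest {D : ℕ} (p : List (EuclideanSpace ℝ (Fin D)) → Prop) [DecidablePred p]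
    (c : List (EuclideanSpace ℝ (Fin D)) → ℝ) (L : List (List (EuclideanSpace ℝ (Fin D))))
    (hL : ∃ l ∈ L, p l) :
    ∃ l ∈ L, p l ∧ (∀ l' ∈ L, p l' → c l ≤ c l') ∧
      L.foldl (fun best l => if p l then (keepBest best l (c l)).val else best) none =
        some (l, c l) := by
  -- Induction from the right: the last list is compared with the best one found so far.
  induction L using List.reverseRecOn with
  | nil => simp at hL
  | append_singleton L a ih =>
    simp only [List.foldl_append, List.foldl_cons, List.foldl_nil]
    by_cases hL' : ∃ l ∈ L, p l
    · obtain ⟨l, hl, hpl, hmin, he⟩ := ih hL'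
      rw [he]
      by_cases ha : p a
      · by_cases hc : c a < c l
        · refine ⟨a, by simp, ha, ?_, by simp [ha, keepBest, hc]⟩
          intro l' hl' hp
          rcases List.mem_append.1 hl' with h | h
          · exact hc.le.trans (hmin l' h hp)
          · simp_all
        · refine ⟨l, by simp [hl], hpl, ?_, by simp [ha, keepBest, hc]⟩
          intro l' hl' hp
          rcases List.mem_append.1 hl' with h | h
          · exact hmin l' h hp
          · simp_all
      · refine ⟨l, by simp [hl], hpl, ?_, by simp [ha]⟩
        intro l' hl' hp
        rcases List.mem_append.1 hl' with h | h
        · exact hmin l' h hp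
        · simp_all
    · have hnone : L.foldl (fun best l => if p l then (keepBest best l (c l)).val else best) none
          = none := by
        clear ih hL
        induction L with
        | nil => rfl
        | cons b L ih =>
          push Not at hL'
          have := hL' b List.mem_cons_self
          rw [List.foldl_cons, if_neg this]
          exact ih (by push Not; exact fun l hl => hL' l (List.mem_cons_of_mem _ hl))
      have ha : p a := by
        obtain ⟨l, hl, hp⟩ := hL
        rcases List.mem_append.1 hl with h | h
        · exact absurd ⟨l, h, hp⟩ hL'
        · simp_all
      rw [hnone]
      refine ⟨a, by simp, ha, ?_, by simp [ha, keepBest]⟩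
      intro l' hl' hp
      rcases List.mem_append.1 hl' with h | h
      · exact absurd ⟨l', h, hp⟩ hL'
      · simp_all

/-- The means enumerated by the algorithm. -/
noncomputable def meansList {D N : ℕ} (x : Fin N → EuclideanSpace ℝ (Fin D)) (n : ℕ) :
    Timed (List (EuclideanSpace ℝ (Fin D))) := do
  let samples ← sequences (List.finRange N) n
  loop (fun acc S => do
    let v ← sampleMean x n S
    op (v :: acc)) [] samples

theorem mem_meansList {D N : ℕ} (x : Fin N → EuclideanSpace ℝ (Fin D)) (n : ℕ)
    (v : EuclideanSpace ℝ (Fin D)) :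
    v ∈ (meansList x n).val ↔ v ∈ candidates x n := by
  simp only [meansList, Timed.bind_val, loop_val, op_val, foldl_cons_eq, sampleMean_val,
    List.append_nil, List.mem_reverse, List.mem_map, mem_sequences, candidates, Set.mem_ofPred_eq]
  constructor
  · rintro ⟨S, ⟨hS, -⟩, rfl⟩
    exact ⟨(S.map x : List _), by simp, by simpa using hS, by simp⟩
  · rintro ⟨S, hS, hn, rfl⟩
    induction S using Quotient.inductionOn with
    | h S =>
      have : ∃ T : List (Fin N), T.map x = S := by
        have : S ∈ Set.range (List.map x) := by
          rw [Set.range_list_map]; exact fun y hy => hS y (by simpa using hy)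
        simpa using this
      obtain ⟨T, rfl⟩ := this
      exact ⟨T, ⟨by simpa using hn, by simp⟩, by simp⟩

theorem length_meansList {D N : ℕ} (x : Fin N → EuclideanSpace ℝ (Fin D)) (n : ℕ) :
    (meansList x n).val.length = N ^ n := by
  simp [meansList, loop_val, length_sequences]

/-- The body of the main loop. -/
noncomputable def searchStep {D N : ℕ} (x : Fin N → EuclideanSpace ℝ (Fin D))
    (w : Fin N → ℕ) (m : ℝ) (best : Option (List (EuclideanSpace ℝ (Fin D)) × ℝ))
    (l : List (EuclideanSpace ℝ (Fin D))) :
    Timed (Option (List (EuclideanSpace ℝ (Fin D)) × ℝ)) := do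
  let ok ← distinct l
  if ok then do
    let c ← evalCost x w m l
    keepBest best l c
  else op best

theorem derandomizedSampling_val {D N : ℕ} (x : Fin N → EuclideanSpace ℝ (Fin D))
    (w : Fin N → ℕ) (m : ℝ) (K : ℕ) (ε : ℝ) :
    (derandomizedSampling x w m K ε).val =
      (loop (searchStep x w m) none
        (sequences (meansList x (sampleSize K ε)).val K).val).val.map Prod.fst := rfl

theorem derandomizedSampling_time {D N : ℕ} (x : Fin N → EuclideanSpace ℝ (Fin D))
    (w : Fin N → ℕ) (m : ℝ) (K : ℕ) (ε : ℝ) :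
    (derandomizedSampling x w m K ε).time =
      3 * (sampleSize K ε + 1) + (meansList x (sampleSize K ε)).time +
      (sequences (meansList x (sampleSize K ε)).val K).time +
      (loop (searchStep x w m) none
        (sequences (meansList x (sampleSize K ε)).val K).val).time + 1 := by
  simp only [derandomizedSampling, meansList, Timed.bind_time, Timed.bind_val, computeSampleSize,
    op_time]
  simp only [add_assoc]
  rfl

/-- If there are `K` different candidates, the algorithm returns the best choice. -/
theorem exists_derandomizedSampling_val {D N : ℕ} (x : Fin N → EuclideanSpace ℝ (Fin D))
    (w : Fin N → ℕ) (m : ℝ) (K : ℕ) (ε : ℝ)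
    (h : ∃ l : List (EuclideanSpace ℝ (Fin D)), l.Nodup ∧ l.length = K ∧
      ∀ v ∈ l, v ∈ candidates x (sampleSize K ε)) :
    ∃ l : List (EuclideanSpace ℝ (Fin D)), (derandomizedSampling x w m K ε).val = some l ∧
      l.Nodup ∧ l.length = K ∧ (∀ v ∈ l, v ∈ candidates x (sampleSize K ε)) ∧
      ∀ l' : List (EuclideanSpace ℝ (Fin D)), l'.Nodup → l'.length = K →
        (∀ v ∈ l', v ∈ candidates x (sampleSize K ε)) →
        (evalCost x w m l).val ≤ (evalCost x w m l').val := by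
  classical
  have hmem (l : List (EuclideanSpace ℝ (Fin D))) :
      l ∈ (sequences (meansList x (sampleSize K ε)).val K).val ↔
        l.length = K ∧ ∀ v ∈ l, v ∈ candidates x (sampleSize K ε) := by
    simp [mem_sequences, mem_meansList]
  obtain ⟨l₀, h1, h2, h3⟩ := h
  obtain ⟨l, hl, hn, hmin, he⟩ := foldl_keepBest List.Nodup (fun l => (evalCost x w m l).val) _
    ⟨l₀, (hmem l₀).2 ⟨h2, h3⟩, h1⟩
  have hstep : (fun best l => (searchStep x w m best l).val) = fun best l =>
      if l.Nodup then (keepBest best l (evalCost x w m l).val).val else best := by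
    funext best l
    by_cases hl : l.Nodup
    · simp [searchStep, hl, (distinct_val l).2 hl]
    · have : (distinct l).val = false := by
        rw [← Bool.not_eq_true, distinct_val]; exact hl
      simp [searchStep, hl, this]
  refine ⟨l, ?_, hn, ((hmem l).1 hl).1, ((hmem l).1 hl).2, fun l' h1 h2 h3 =>
    hmin l' ((hmem l').2 ⟨h2, h3⟩) h1⟩
  rw [derandomizedSampling_val, loop_val, hstep, he]
  rfl

/-! ### Optimal memberships -/

/-- Hölder's inequality with exponents `m` and `m / (m - 1)`, applied to `1 = ∑ (r k * d k ^ (1 /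
m)) * d k ^ (-(1 / m))`, and raised to the power `m`. -/
theorem rpow_sum_rpow_le_sum {ι : Type*} [Fintype ι] {m : ℝ} (hm : 1 < m) {d r : ι → ℝ}
    (hd : ∀ k, 0 < d k) (hr : ∀ k, 0 ≤ r k) (hsum : ∑ k, r k = 1) :
    (∑ k, d k ^ (1 / (1 - m))) ^ (1 - m) ≤ ∑ k, r k ^ m * d k := by
  have hm0 : 0 < m := by linarith
  have hm1 : 1 - m ≠ 0 := by linarith
  have hm2 : m - 1 ≠ 0 := by linarith
  have hne : Nonempty ι := by
    by_contra h
    rw [not_nonempty_iff] at h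
    simp at hsum
  set S := ∑ k, d k ^ (1 / (1 - m)) with hS
  have hSpos : 0 < S := Finset.sum_pos (fun k _ => Real.rpow_pos_of_pos (hd k) _) Finset.univ_nonempty
  set B := ∑ k, r k ^ m * d k with hB
  have hB0 : 0 ≤ B :=
    Finset.sum_nonneg fun k _ => mul_nonneg (Real.rpow_nonneg (hr k) _) (hd k).le
  have hconj : m.HolderConjugate (m / (m - 1)) := Real.HolderConjugate.conjExponent hm
  have hold := Real.inner_le_Lp_mul_Lq_of_nonneg Finset.univ hconj
    (f := fun k => r k * d k ^ (1 / m)) (g := fun k => d k ^ (-(1 / m)))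
    (fun k _ => mul_nonneg (hr k) (Real.rpow_nonneg (hd k).le _))
    (fun k _ => Real.rpow_nonneg (hd k).le _)
  have e1 : ∑ k, r k * d k ^ (1 / m) * d k ^ (-(1 / m)) = 1 := by
    rw [← hsum]
    refine Finset.sum_congr rfl fun k _ => ?_
    rw [mul_assoc, ← Real.rpow_add (hd k)]
    simp
  have e2 : ∑ k, (r k * d k ^ (1 / m)) ^ m = B := by
    refine Finset.sum_congr rfl fun k _ => ?_
    rw [Real.mul_rpow (hr k) (Real.rpow_nonneg (hd k).le _), ← Real.rpow_mul (hd k).le,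
      one_div_mul_cancel hm0.ne', Real.rpow_one]
  have e3 : ∑ k, (d k ^ (-(1 / m))) ^ (m / (m - 1)) = S := by
    refine Finset.sum_congr rfl fun k _ => ?_
    rw [← Real.rpow_mul (hd k).le]
    congr 1
    rw [show 1 - m = -(m - 1) by ring]
    field_simp
  rw [e1, e2, e3] at hold
  have h1 : 1 ≤ B * S ^ (m - 1) := by
    calc (1 : ℝ) = 1 ^ m := (Real.one_rpow m).symm
      _ ≤ (B ^ (1 / m) * S ^ (1 / (m / (m - 1)))) ^ m :=
        Real.rpow_le_rpow zero_le_one hold hm0.le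
      _ = B * S ^ (m - 1) := by
        rw [Real.mul_rpow (Real.rpow_nonneg hB0 _) (Real.rpow_nonneg hSpos.le _),
          ← Real.rpow_mul hB0, ← Real.rpow_mul hSpos.le, one_div_mul_cancel hm0.ne', Real.rpow_one]
        congr 2
        field_simp
  calc S ^ (1 - m) = 1 * S ^ (1 - m) := (one_mul _).symm
    _ ≤ (B * S ^ (m - 1)) * S ^ (1 - m) :=
      mul_le_mul_of_nonneg_right h1 (Real.rpow_nonneg hSpos.le _)
    _ = B := by
      rw [mul_assoc, ← Real.rpow_add hSpos]
      simp

/-- The equality case of the preceding bound: memberships proportional to `d k ^ (1 / (1 - m))`. -/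
theorem exists_sum_eq_rpow_sum_rpow {ι : Type*} [Fintype ι] [Nonempty ι] {m : ℝ} (hm : 1 < m)
    {d : ι → ℝ} (hd : ∀ k, 0 < d k) :
    ∃ r : ι → ℝ, (∀ k, 0 ≤ r k) ∧ ∑ k, r k = 1 ∧
      ∑ k, r k ^ m * d k = (∑ k, d k ^ (1 / (1 - m))) ^ (1 - m) := by
  have hm1 : 1 - m ≠ 0 := by linarith
  set S := ∑ k, d k ^ (1 / (1 - m)) with hS
  have hSpos : 0 < S := Finset.sum_pos (fun k _ => Real.rpow_pos_of_pos (hd k) _) Finset.univ_nonempty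
  refine ⟨fun k => d k ^ (1 / (1 - m)) / S,
    fun k => div_nonneg (Real.rpow_nonneg (hd k).le _) hSpos.le, ?_, ?_⟩
  · rw [← Finset.sum_div, div_self hSpos.ne']
  · have (k : ι) : (d k ^ (1 / (1 - m)) / S) ^ m * d k = d k ^ (1 / (1 - m)) / S ^ m := by
      rw [Real.div_rpow (Real.rpow_nonneg (hd k).le _) hSpos.le, ← Real.rpow_mul (hd k).le,
        div_mul_eq_mul_div]
      congr 1
      nth_rw 2 [← Real.rpow_one (d k)]
      rw [← Real.rpow_add (hd k)]
      congr 1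
      field_simp
      ring
    rw [Finset.sum_congr rfl fun k _ => this k, ← Finset.sum_div, Real.rpow_sub hSpos,
      Real.rpow_one]

theorem sum_coe_eq_sum_map {α : Type*} {l : List α} {M : Finset α} (hl : l.Nodup)
    (hM : ∀ v, v ∈ l ↔ v ∈ M) (f : α → ℝ) : ∑ v : M, f v = (l.map f).sum := by
  classical
  have : M = l.toFinset := by ext v; simp [hM]
  rw [Finset.sum_coe_sort M f, this, List.sum_toFinset f hl]

theorem pointCost_le {D : ℕ} {m : ℝ} (hm : 1 < m) {l : List (EuclideanSpace ℝ (Fin D))}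
    {M : Finset (EuclideanSpace ℝ (Fin D))} (hl : l.Nodup) (hM : ∀ v, v ∈ l ↔ v ∈ M)
    (y : EuclideanSpace ℝ (Fin D)) {r : M → ℝ} (hr : ∀ k, 0 ≤ r k) (hsum : ∑ k, r k = 1) :
    (pointCost m l y).val ≤ ∑ k : M, r k ^ m * ‖y - k‖ ^ 2 := by
  rw [pointCost_val]
  split_ifs with hy
  · exact Finset.sum_nonneg fun k _ => mul_nonneg (Real.rpow_nonneg (hr k) _) (sq_nonneg _)
  · rw [← sum_coe_eq_sum_map hl hM]
    refine rpow_sum_rpow_le_sum hm (d := fun k : M => ‖y - k‖ ^ 2) (fun k => ?_) hr hsum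
    have : y - k ≠ 0 := by
      rw [sub_ne_zero]; rintro rfl; exact hy ((hM _).2 k.2)
    positivity

theorem exists_eq_pointCost {D : ℕ} {m : ℝ} (hm : 1 < m) {l : List (EuclideanSpace ℝ (Fin D))}
    {M : Finset (EuclideanSpace ℝ (Fin D))} (hl : l.Nodup) (hM : ∀ v, v ∈ l ↔ v ∈ M)
    (hne : M.Nonempty) (y : EuclideanSpace ℝ (Fin D)) :
    ∃ r : M → ℝ, (∀ k, 0 ≤ r k) ∧ ∑ k, r k = 1 ∧
      ∑ k : M, r k ^ m * ‖y - k‖ ^ 2 = (pointCost m l y).val := by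
  classical
  rw [pointCost_val]
  split_ifs with hy
  -- A point that is itself a mean belongs entirely to that mean, at distance zero; the other terms
  -- vanish since `0 ^ m = 0`.
  · refine ⟨fun k => if k = ⟨y, (hM y).1 hy⟩ then 1 else 0, fun k => by positivity, by simp, ?_⟩
    refine Finset.sum_eq_zero fun k _ => ?_
    by_cases hk : k = ⟨y, (hM y).1 hy⟩
    · simp [hk]
    · simp [hk, Real.zero_rpow (by linarith : m ≠ 0)]
  · rw [← sum_coe_eq_sum_map hl hM]
    have : Nonempty M := hne.to_subtype
    refine exists_sum_eq_rpow_sum_rpow hm (d := fun k : M => ‖y - k‖ ^ 2) fun k => ?_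
    have : y - k ≠ 0 := by
      rw [sub_ne_zero]; rintro rfl; exact hy ((hM _).2 k.2)
    positivity

theorem cost_nonneg {D N : ℕ} {ι : Type*} [Fintype ι] (x : Fin N → EuclideanSpace ℝ (Fin D))
    (w : Fin N → ℕ) (m : ℝ) (μ : ι → EuclideanSpace ℝ (Fin D)) {r : Fin N → ι → ℝ}
    (hr : IsMembership r) : 0 ≤ cost x w m μ r :=
  Finset.sum_nonneg fun i _ => mul_nonneg (Nat.cast_nonneg _) <|
    Finset.sum_nonneg fun k _ => mul_nonneg (Real.rpow_nonneg (hr.1 i k).1 _) (sq_nonneg _)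

theorem setCost_le_cost {D N : ℕ} (x : Fin N → EuclideanSpace ℝ (Fin D)) (w : Fin N → ℕ) (m : ℝ)
    (M : Finset (EuclideanSpace ℝ (Fin D))) {r : Fin N → M → ℝ} (hr : IsMembership r) :
    setCost x w m M ≤ cost x w m (fun v : M => (v : EuclideanSpace ℝ (Fin D))) r :=
  csInf_le ⟨0, by rintro _ ⟨r, hr, rfl⟩; exact cost_nonneg _ _ _ _ hr⟩ ⟨r, hr, rfl⟩

theorem isMembership_of_nonneg {N : ℕ} {ι : Type*} [Fintype ι] {r : Fin N → ι → ℝ}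
    (h0 : ∀ i k, 0 ≤ r i k) (h1 : ∀ i, ∑ k, r i k = 1) : IsMembership r :=
  ⟨fun i k => ⟨h0 i k,
    (Finset.single_le_sum (fun k _ => h0 i k) (Finset.mem_univ k)).trans (h1 i).le⟩, h1⟩

/-- The explicit optimal memberships compute the cost of a set of means. -/
theorem evalCost_eq_setCost {D N : ℕ} (x : Fin N → EuclideanSpace ℝ (Fin D)) (w : Fin N → ℕ)
    {m : ℝ} (hm : 1 < m) {l : List (EuclideanSpace ℝ (Fin D))}
    {M : Finset (EuclideanSpace ℝ (Fin D))} (hl : l.Nodup) (hM : ∀ v, v ∈ l ↔ v ∈ M)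
    (hne : M.Nonempty) : (evalCost x w m l).val = setCost x w m M := by
  symm
  refine IsLeast.csInf_eq ⟨?_, ?_⟩
  · choose r h0 h1 h2 using fun i => exists_eq_pointCost hm hl hM hne (x i)
    refine ⟨r, isMembership_of_nonneg h0 h1, ?_⟩
    rw [evalCost_val, cost]
    exact Finset.sum_congr rfl fun i _ => by rw [h2]
  · rintro _ ⟨r, hr, rfl⟩
    rw [evalCost_val, cost]
    exact Finset.sum_le_sum fun i _ => mul_le_mul_of_nonneg_left
      (pointCost_le hm hl hM (x i) (fun k => (hr.1 i k).1) (hr.2 i)) (Nat.cast_nonneg _)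

/-! ### Approximation of a cluster by candidate means -/

section Cluster

variable {ι E : Type*} [Fintype ι] [NormedAddCommGroup E] [InnerProductSpace ℝ E]

/-- The parallel axis identity. The centroid is described by vanishing weighted deviations, so no
division by the total weight is needed. -/
theorem sum_mul_norm_sub_sq {a : ι → ℝ} {x : ι → E} {c : E}
    (hc : ∑ i, a i • (x i - c) = 0) (v : E) :
    ∑ i, a i * ‖x i - v‖ ^ 2 = ∑ i, a i * ‖x i - c‖ ^ 2 + (∑ i, a i) * ‖v - c‖ ^ 2 := by
  have h (i : ι) : a i * ‖x i - v‖ ^ 2 =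
      a i * ‖x i - c‖ ^ 2 - 2 * inner ℝ (a i • (x i - c)) (v - c) + a i * ‖v - c‖ ^ 2 := by
    rw [show x i - v = (x i - c) - (v - c) by abel, norm_sub_sq_real, real_inner_smul_left]
    ring
  rw [Finset.sum_congr rfl fun i _ => h i, Finset.sum_add_distrib, Finset.sum_sub_distrib,
    ← Finset.mul_sum, ← sum_inner, hc, inner_zero_left, ← Finset.sum_mul]
  ring

theorem exists_le_of_sum_mul_le {a f : ι → ℝ} (ha : ∀ i, 0 ≤ a i) (hA : 0 < ∑ i, a i) {B : ℝ}
    (h : ∑ i, a i * f i ≤ (∑ i, a i) * B) : ∃ i, f i ≤ B := by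
  by_contra! hf
  have h0 : ∑ i, a i * (f i - B) ≤ 0 := by
    simp only [mul_sub, Finset.sum_sub_distrib, ← Finset.sum_mul]
    linarith
  have hnn : ∀ i ∈ Finset.univ, 0 ≤ a i * (f i - B) := fun i _ =>
    mul_nonneg (ha i) (sub_nonneg.2 (hf i).le)
  have hz := (Finset.sum_eq_zero_iff_of_nonneg hnn).1 (le_antisymm h0 (Finset.sum_nonneg hnn))
  have : ∑ i, a i = 0 := Finset.sum_eq_zero fun i hi =>
    (mul_eq_zero.1 (hz i hi)).resolve_right (sub_pos.2 (hf i)).ne'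
  exact hA.ne' this

/-- A sample of `k` points whose mean is as close to the centroid as that of a random sample. -/
theorem exists_sample {a : ι → ℝ} (ha : ∀ i, 0 ≤ a i) (hA : 0 < ∑ i, a i) {x : ι → E} {c : E}
    (hc : ∑ i, a i • (x i - c) = 0) (k : ℕ) :
    ∃ S : Multiset E, (∀ y ∈ S, y ∈ Set.range x) ∧ Multiset.card S = k ∧
      (∑ i, a i) * ‖S.sum - (k : ℝ) • c‖ ^ 2 ≤ k * ∑ i, a i * ‖x i - c‖ ^ 2 := by
  induction k with
  | zero => exact ⟨0, by simp, rfl, by simp⟩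
  | succ k ih =>
    obtain ⟨S, hS, hk, hle⟩ := ih
    set s := S.sum - (k : ℝ) • c with hs
    -- With `s` the accumulated deviation, the weighted average of `‖s + (x i - c)‖ ^ 2` exceeds
    -- `‖s‖ ^ 2` by exactly the variance, because the cross term vanishes. Some point does no worse
    -- than the average.
    obtain ⟨i, hi⟩ := exists_le_of_sum_mul_le (f := fun i => (∑ j, a j) * ‖x i - (c - s)‖ ^ 2)
      (B := ∑ i, a i * ‖x i - c‖ ^ 2 + (∑ i, a i) * ‖s‖ ^ 2) ha hA (by
        have := sum_mul_norm_sub_sq hc (c - s)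
        rw [sub_sub_cancel_left, norm_neg] at this
        rw [← this, Finset.mul_sum]
        exact (Finset.sum_congr rfl fun i _ => by ring).le)
    refine ⟨x i ::ₘ S, ?_, by simp [hk], ?_⟩
    · intro y hy
      rcases Multiset.mem_cons.1 hy with rfl | hy
      · exact ⟨i, rfl⟩
      · exact hS y hy
    · have : (x i ::ₘ S).sum - ((k + 1 : ℕ) : ℝ) • c = x i - (c - s) := by
        rw [Multiset.sum_cons, hs]
        push_cast
        module
      rw [this]
      push_cast
      linarith

/-- Either some point is very close to the centroid, or two points are not too far from it. -/
theorem exists_close_or_exists_pair {a : ι → ℝ} (ha : ∀ i, 0 ≤ a i) (hA : 0 < ∑ i, a i)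
    {x : ι → E} {c : E} (hc : ∑ i, a i • (x i - c) = 0) {ε : ℝ} (h0 : 0 < ε) (h1 : ε < 1) :
    (∃ i, (∑ j, a j) * ‖x i - c‖ ^ 2 ≤ ε / 60 * ∑ j, a j * ‖x j - c‖ ^ 2) ∨
    ∃ i j, i ≠ j ∧ (∑ j, a j) * ‖x i - c‖ ^ 2 ≤ 64 / ε * ∑ j, a j * ‖x j - c‖ ^ 2 ∧
      (∑ j, a j) * ‖x j - c‖ ^ 2 ≤ 64 / ε * ∑ j, a j * ‖x j - c‖ ^ 2 := by
  classical
  set A := ∑ j, a j with hAdef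
  set V := ∑ j, a j * ‖x j - c‖ ^ 2 with hV
  have hV0 : 0 ≤ V := Finset.sum_nonneg fun i _ => mul_nonneg (ha i) (sq_nonneg _)
  obtain ⟨i, hi⟩ := exists_le_of_sum_mul_le (f := fun i => A * ‖x i - c‖ ^ 2) (B := V) ha hA (by
    rw [hV, Finset.mul_sum]
    exact (Finset.sum_congr rfl fun i _ => by ring).le)
  by_cases hex : ∃ j, i ≠ j ∧ A * ‖x j - c‖ ^ 2 ≤ 64 / ε * V
  · obtain ⟨j, hij, hj⟩ := hex
    refine Or.inr ⟨i, j, hij, hi.trans ?_, hj⟩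
    have : 1 ≤ 64 / ε := by rw [le_div_iff₀ h0]; linarith
    nlinarith
  push Not at hex
  left
  refine ⟨i, ?_⟩
  rcases hV0.eq_or_lt with hz | hpos
  · rw [← hz] at hi ⊢; simpa using hi
  set s := Finset.univ.erase i with hsdef
  set q := ∑ j ∈ s, a j with hq
  set Q := ∑ j ∈ s, a j * ‖x j - c‖ ^ 2 with hQ
  have hq0 : 0 ≤ q := Finset.sum_nonneg fun i _ => ha i
  have hAq : A = a i + q := (Finset.add_sum_erase _ _ (Finset.mem_univ i)).symm
  have hVQ : V = a i * ‖x i - c‖ ^ 2 + Q :=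
    (Finset.add_sum_erase _ (fun j => a j * ‖x j - c‖ ^ 2) (Finset.mem_univ i)).symm
  have hQV : Q ≤ V := by rw [hVQ]; linarith [mul_nonneg (ha i) (sq_nonneg ‖x i - c‖)]
  -- Markov's inequality: all points other than `i` are far from the centroid, so together they
  -- carry at most the fraction `ε / 64` of the weight.
  have hmark : q * (64 / ε * V) ≤ A * Q := by
    rw [hq, hQ, Finset.sum_mul, Finset.mul_sum s _ A]
    refine Finset.sum_le_sum fun j hj => ?_
    have := (hex j (Finset.ne_of_mem_erase hj).symm).le
    nlinarith [mul_le_mul_of_nonneg_left this (ha j)]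
  have hqA : 64 * q ≤ ε * A := by
    have h2 : q * (64 / ε * V) ≤ A * V := hmark.trans (mul_le_mul_of_nonneg_left hQV hA.le)
    have h3 : (q * (64 / ε)) * V ≤ A * V := by linarith
    have h4 := le_of_mul_le_mul_right h3 hpos
    rw [mul_div_assoc', div_le_iff₀ h0] at h4
    linarith
  have hai : 63 / 64 * A ≤ a i := by nlinarith
  -- The weighted deviations sum to zero, so the heavy point is balanced by the light remainder.
  -- Cauchy–Schwarz then bounds its distance to the centroid.
  have hvec : a i • (x i - c) = - ∑ j ∈ s, a j • (x j - c) := by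
    rw [eq_neg_iff_add_eq_zero, hsdef, Finset.add_sum_erase _ (fun j => a j • (x j - c))
      (Finset.mem_univ i), hc]
  have hnorm : a i * ‖x i - c‖ ≤ ∑ j ∈ s, a j * ‖x j - c‖ := by
    calc a i * ‖x i - c‖ = ‖a i • (x i - c)‖ := by
          rw [norm_smul, Real.norm_of_nonneg (ha i)]
      _ = ‖∑ j ∈ s, a j • (x j - c)‖ := by rw [hvec, norm_neg]
      _ ≤ ∑ j ∈ s, ‖a j • (x j - c)‖ := norm_sum_le _ _
      _ = _ := Finset.sum_congr rfl fun j _ => by rw [norm_smul, Real.norm_of_nonneg (ha j)]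
  have hcs : (∑ j ∈ s, a j * ‖x j - c‖) ^ 2 ≤ q * Q :=
    Finset.sum_sq_le_sum_mul_sum_of_sq_le_mul s (fun j _ => ha j)
      (fun j _ => mul_nonneg (ha j) (sq_nonneg _)) (fun j _ => (by ring : _ = _).le)
  have h5 : (a i * ‖x i - c‖) ^ 2 ≤ q * V := by
    calc (a i * ‖x i - c‖) ^ 2 ≤ (∑ j ∈ s, a j * ‖x j - c‖) ^ 2 :=
          pow_le_pow_left₀ (mul_nonneg (ha i) (norm_nonneg _)) hnorm 2
      _ ≤ q * Q := hcs
      _ ≤ q * V := by gcongr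
  have h6 : (63 / 64 * A) ^ 2 * ‖x i - c‖ ^ 2 ≤ ε * A / 64 * V := by
    calc (63 / 64 * A) ^ 2 * ‖x i - c‖ ^ 2 ≤ (a i) ^ 2 * ‖x i - c‖ ^ 2 := by gcongr
      _ = (a i * ‖x i - c‖) ^ 2 := by ring
      _ ≤ q * V := h5
      _ ≤ ε * A / 64 * V := by gcongr; linarith
  have h7 : A * ((63 / 64) ^ 2 * (A * ‖x i - c‖ ^ 2)) ≤ A * (ε / 64 * V) := by
    calc _ = (63 / 64 * A) ^ 2 * ‖x i - c‖ ^ 2 := by ring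
      _ ≤ _ := h6
      _ = _ := by ring
  -- The constant 60 comes from `(64 / 63) ^ 2 / 64 ≤ 1 / 60`.
  have h8 := le_of_mul_le_mul_left h7 hA
  have : 0 ≤ ε * V := by positivity
  linarith

end Cluster

/-! ### Families of different good candidates -/

theorem mem_candidates_of_add {D N : ℕ} (x : Fin N → EuclideanSpace ℝ (Fin D)) {n k p q : ℕ}
    {S : Multiset (EuclideanSpace ℝ (Fin D))} (hS : ∀ y ∈ S, y ∈ Set.range x)
    (hk : Multiset.card S = k) (hn : k + p + q = n) (i j : Fin N) :
    (n : ℝ)⁻¹ • (S.sum + (p : ℝ) • x i + (q : ℝ) • x j) ∈ candidates x n := by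
  refine ⟨S + Multiset.replicate p (x i) + Multiset.replicate q (x j), ?_, by simp [hk, hn], ?_⟩
  · intro y hy
    simp only [Multiset.mem_add, Multiset.mem_replicate] at hy
    rcases hy with (hy | hy) | hy
    · exact hS y hy
    · exact ⟨i, hy.2.symm⟩
    · exact ⟨j, hy.2.symm⟩
  · simp [Nat.cast_smul_eq_nsmul]

/-- Trading one copy of `y` for a copy of `z` shifts the mean by the nonzero vector `(z - y) / n`,
so different proportions give different means. -/
theorem injOn_smul_add {E : Type*} [AddCommGroup E] [Module ℝ E] {n K : ℕ} (hn : 0 < n)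
    (s : E) {y z : E} (h : y ≠ z) :
    Set.InjOn (fun j : ℕ => (n : ℝ)⁻¹ • (s + ((K - j : ℕ) : ℝ) • y + (j : ℝ) • z))
      (Finset.range K) := by
  intro j hj j' hj' he
  have hn' : (n : ℝ)⁻¹ ≠ 0 := by positivity
  have he' := smul_right_injective E hn' he
  simp only [Finset.coe_range, Set.mem_Iio] at hj hj'
  rw [Nat.cast_sub hj.le, Nat.cast_sub hj'.le] at he'
  have : ((j : ℝ) - j') • (z - y) = 0 := by
    rw [← sub_eq_zero] at he'
    rw [← he']
    module
  rcases smul_eq_zero.1 this with h' | h'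
  · exact_mod_cast sub_eq_zero.1 h'
  · exact absurd (sub_eq_zero.1 h').symm h

/-- Moving from a data point towards its nearest neighbour yields many candidates that are almost
as good as the data point for all the other points. -/
theorem exists_candidates_near_point {D N K n : ℕ} {x : Fin N → EuclideanSpace ℝ (Fin D)}
    (hx : Function.Injective x) (hN : 2 ≤ N) (hK : 1 ≤ K) {ε : ℝ} (h0 : 0 < ε)
    (hn : 64 * (K : ℝ) ≤ n * ε) (hKn : K ≤ n) (i : Fin N) :
    ∃ O : Finset (EuclideanSpace ℝ (Fin D)), x i ∈ O ∧ K ≤ O.card ∧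
      (∀ v ∈ O, v ∈ candidates x n) ∧
      ∀ v ∈ O, ∀ j ≠ i, ‖x j - v‖ ^ 2 ≤ (1 + ε / 64) ^ 2 * ‖x j - x i‖ ^ 2 := by
  classical
  have hn0 : 0 < n := by omega
  have hn' : (0 : ℝ) < n := by exact_mod_cast hn0
  have hne : (Finset.univ.erase i).Nonempty := by
    rw [← Finset.card_pos, Finset.card_erase_of_mem (Finset.mem_univ i)]
    simp
    omega
  obtain ⟨i', hi', hmin⟩ := Finset.exists_min_image _ (fun j => ‖x j - x i‖) hne
  have hii' : x i ≠ x i' := fun h => Finset.ne_of_mem_erase hi' (hx h).symm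
  -- The multiset has `n - j` copies of `x i` and `j < K` copies of its nearest neighbour `x i'`.
  -- The shift is at most `K / n ≤ ε / 64` times the distance from `x i` to any other data point.
  set f : ℕ → EuclideanSpace ℝ (Fin D) := fun j =>
    (n : ℝ)⁻¹ • (((n - K : ℕ) : ℝ) • x i + ((K - j : ℕ) : ℝ) • x i + (j : ℝ) • x i') with hf
  have hf' (j : ℕ) (hj : j < K) : f j = x i + ((j : ℝ) / n) • (x i' - x i) := by
    rw [hf]
    simp only
    rw [Nat.cast_sub hj.le, Nat.cast_sub hKn]
    rw [show ((n : ℝ) - K) • x i + ((K : ℝ) - j) • x i + (j : ℝ) • x i' =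
      (n : ℝ) • x i + (j : ℝ) • (x i' - x i) by module, smul_add, smul_smul, smul_smul,
      inv_mul_cancel₀ hn'.ne', one_smul, inv_mul_eq_div]
  refine ⟨(Finset.range K).image f, ?_, ?_, ?_, ?_⟩
  · exact Finset.mem_image.2 ⟨0, Finset.mem_range.2 hK, by rw [hf' 0 hK]; simp⟩
  · rw [Finset.card_image_of_injOn (injOn_smul_add hn0 _ hii'), Finset.card_range]
  · intro v hv
    obtain ⟨j, hj, rfl⟩ := Finset.mem_image.1 hv
    rw [Finset.mem_range] at hj
    have := mem_candidates_of_add x (S := Multiset.replicate (n - K) (x i)) (k := n - K)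
      (p := K - j) (q := j) (n := n) (fun y hy => ⟨i, (Multiset.eq_of_mem_replicate hy).symm⟩)
      (by simp) (by omega) i i'
    simpa [hf, Nat.cast_smul_eq_nsmul] using this
  · intro v hv j hji
    obtain ⟨p, hp, rfl⟩ := Finset.mem_image.1 hv
    rw [Finset.mem_range] at hp
    rw [hf' p hp, ← mul_pow]
    refine pow_le_pow_left₀ (norm_nonneg _) ?_ 2
    have h1 : ‖x i' - x i‖ ≤ ‖x j - x i‖ :=
      hmin j (Finset.mem_erase.2 ⟨hji, Finset.mem_univ _⟩)
    have h2 : (p : ℝ) / n ≤ ε / 64 := by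
      have : (p : ℝ) ≤ K := by exact_mod_cast hp.le
      rw [div_le_div_iff₀ hn' (by norm_num)]
      linarith
    calc ‖x j - (x i + ((p : ℝ) / n) • (x i' - x i))‖
        = ‖(x j - x i) - ((p : ℝ) / n) • (x i' - x i)‖ := by rw [sub_add_eq_sub_sub]
      _ ≤ ‖x j - x i‖ + ‖((p : ℝ) / n) • (x i' - x i)‖ := norm_sub_le _ _
      _ = ‖x j - x i‖ + (p : ℝ) / n * ‖x i' - x i‖ := by
        rw [norm_smul, Real.norm_of_nonneg (by positivity)]
      _ ≤ ‖x j - x i‖ + ε / 64 * ‖x j - x i‖ := by gcongr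
      _ = (1 + ε / 64) * ‖x j - x i‖ := by ring

/-- If two points are not too far from the centroid, many candidates are close to it. -/
theorem exists_candidates_near_centroid {D N K n : ℕ} {x : Fin N → EuclideanSpace ℝ (Fin D)}
    {a : Fin N → ℝ} (ha : ∀ i, 0 ≤ a i) (hA : 0 < ∑ i, a i) {c : EuclideanSpace ℝ (Fin D)}
    (hc : ∑ i, a i • (x i - c) = 0) (hK : 1 ≤ K) {ε : ℝ} (h0 : 0 < ε)
    (hn : 64 * (K : ℝ) ≤ n * ε) (hKn : K ≤ n) {i i' : Fin N} (hii' : x i ≠ x i')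
    (hi : (∑ j, a j) * ‖x i - c‖ ^ 2 ≤ 64 / ε * ∑ j, a j * ‖x j - c‖ ^ 2)
    (hi' : (∑ j, a j) * ‖x i' - c‖ ^ 2 ≤ 64 / ε * ∑ j, a j * ‖x j - c‖ ^ 2) :
    ∃ O : Finset (EuclideanSpace ℝ (Fin D)), K ≤ O.card ∧
      (∀ v ∈ O, v ∈ candidates x n) ∧
      ∀ v ∈ O, (∑ j, a j) * ‖v - c‖ ^ 2 ≤ ε * ∑ j, a j * ‖x j - c‖ ^ 2 := by
  classical
  set A := ∑ j, a j with hAdef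
  set V := ∑ j, a j * ‖x j - c‖ ^ 2 with hV
  have hV0 : 0 ≤ V := Finset.sum_nonneg fun i _ => mul_nonneg (ha i) (sq_nonneg _)
  have hn0 : 0 < n := by omega
  have hn' : (0 : ℝ) < n := by exact_mod_cast hn0
  have hK' : (1 : ℝ) ≤ K := by exact_mod_cast hK
  -- Only `n - K` places go to the averaged sample; the other `K` are reserved for copies of `x i`
  -- and `x i'`, which make the candidates different.
  obtain ⟨S, hS, hcard, hle⟩ := exists_sample ha hA hc (n - K)
  refine ⟨(Finset.range K).image fun j : ℕ =>
    (n : ℝ)⁻¹ • (S.sum + ((K - j : ℕ) : ℝ) • x i + (j : ℝ) • x i'), ?_, ?_, ?_⟩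
  · rw [Finset.card_image_of_injOn (injOn_smul_add hn0 _ hii'), Finset.card_range]
  · intro v hv
    obtain ⟨j, hj, rfl⟩ := Finset.mem_image.1 hv
    rw [Finset.mem_range] at hj
    exact mem_candidates_of_add x hS hcard (by omega) i i'
  · intro v hv
    obtain ⟨j, hj, rfl⟩ := Finset.mem_image.1 hv
    rw [Finset.mem_range] at hj
    -- The radius that the hypotheses allow for the distances of `x i` and `x i'` to the centroid.
    set ρ := Real.sqrt (64 / ε * V / A) with hρ
    have hρ2 : A * ρ ^ 2 = 64 / ε * V := by
      rw [hρ, Real.sq_sqrt (by positivity)]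
      field_simp
    have hρle {y : EuclideanSpace ℝ (Fin D)} (hy : A * ‖y - c‖ ^ 2 ≤ 64 / ε * V) :
        ‖y - c‖ ≤ ρ := by
      apply Real.le_sqrt_of_sq_le
      rw [le_div_iff₀ hA]
      linarith
    set s := S.sum - ((n - K : ℕ) : ℝ) • c with hs
    set u := ((K - j : ℕ) : ℝ) • (x i - c) + (j : ℝ) • (x i' - c) with hu
    have hv : (n : ℝ)⁻¹ • (S.sum + ((K - j : ℕ) : ℝ) • x i + (j : ℝ) • x i') - c =
        (n : ℝ)⁻¹ • (s + u) := by
      have : c = (n : ℝ)⁻¹ • ((n : ℝ) • c) := by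
        rw [smul_smul, inv_mul_cancel₀ hn'.ne', one_smul]
      nth_rw 1 [this]
      rw [← smul_sub, hs, hu, Nat.cast_sub hj.le, Nat.cast_sub hKn]
      congr 1
      module
    have hu1 : ‖u‖ ≤ K * ρ := by
      calc ‖u‖ ≤ ‖((K - j : ℕ) : ℝ) • (x i - c)‖ + ‖(j : ℝ) • (x i' - c)‖ := norm_add_le _ _
        _ = ((K - j : ℕ) : ℝ) * ‖x i - c‖ + (j : ℝ) * ‖x i' - c‖ := by
          rw [norm_smul, norm_smul, Real.norm_of_nonneg (by positivity),
            Real.norm_of_nonneg (by positivity)]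
        _ ≤ ((K - j : ℕ) : ℝ) * ρ + (j : ℝ) * ρ := by gcongr <;> apply hρle <;> assumption
        _ = K * ρ := by rw [Nat.cast_sub hj.le]; ring
    have hsq : ‖s + u‖ ^ 2 ≤ 2 * ‖s‖ ^ 2 + 2 * ‖u‖ ^ 2 := by
      have h1 := norm_add_le s u
      have h2 := pow_le_pow_left₀ (norm_nonneg _) h1 2
      nlinarith [sq_nonneg (‖s‖ - ‖u‖)]
    -- The sampled part `s` and the filler `u` each contribute at most `n ^ 2 * ε / 64 * V`; both
    -- bounds rest on `64 * K ≤ n * ε`.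
    have h1 : A * ‖s‖ ^ 2 ≤ n ^ 2 * ε / 64 * V := by
      have : ((n - K : ℕ) : ℝ) ≤ n ^ 2 * ε / 64 := by
        have h2 : ((n - K : ℕ) : ℝ) ≤ n := by exact_mod_cast Nat.sub_le _ _
        nlinarith
      exact hle.trans (by gcongr)
    have h2 : A * ‖u‖ ^ 2 ≤ n ^ 2 * ε / 64 * V := by
      calc A * ‖u‖ ^ 2 ≤ A * (K * ρ) ^ 2 := by gcongr
        _ = K ^ 2 * (A * ρ ^ 2) := by ring
        _ = (64 * K) ^ 2 / (64 * ε) * V := by rw [hρ2]; field_simp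
        _ ≤ (n * ε) ^ 2 / (64 * ε) * V := by gcongr
        _ = n ^ 2 * ε / 64 * V := by field_simp
    rw [hv, norm_smul, mul_pow, norm_inv, Real.norm_of_nonneg hn'.le, inv_pow]
    rw [show A * (((n : ℝ) ^ 2)⁻¹ * ‖s + u‖ ^ 2) = (A * ‖s + u‖ ^ 2) / n ^ 2 by ring,
      div_le_iff₀ (by positivity)]
    have h3 : A * ‖s + u‖ ^ 2 ≤ A * (2 * ‖s‖ ^ 2 + 2 * ‖u‖ ^ 2) := by gcongr
    have h4 : 0 ≤ n ^ 2 * ε * V := by positivity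
    linarith

/-- For each weighted cluster there are `K` candidates that are as good as any mean `μ`, up to the
factor `1 + ε` and the cost of one point that is itself among these candidates. -/
theorem exists_candidates_for_cluster {D N K n : ℕ} {x : Fin N → EuclideanSpace ℝ (Fin D)}
    (hx : Function.Injective x) (hN : 2 ≤ N) (hK : 1 ≤ K) {ε : ℝ} (h0 : 0 < ε) (h1 : ε < 1)
    (hn : 64 * (K : ℝ) ≤ n * ε) (hKn : K ≤ n) {a : Fin N → ℝ} (ha : ∀ i, 0 ≤ a i)
    (μ : EuclideanSpace ℝ (Fin D)) :
    ∃ z, ∃ O : Finset (EuclideanSpace ℝ (Fin D)), z ∈ O ∧ K ≤ O.card ∧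
      (∀ v ∈ O, v ∈ candidates x n) ∧
      ∀ v ∈ O, ∑ i with x i ≠ z, a i * ‖x i - v‖ ^ 2 ≤
        (1 + ε) * ∑ i, a i * ‖x i - μ‖ ^ 2 := by
  have hA0 : 0 ≤ ∑ i, a i := Finset.sum_nonneg fun i _ => ha i
  rcases hA0.eq_or_lt with hA | hA
  -- A cluster without weight costs nothing anywhere, but it must still offer `K` candidates.
  · have hz (i : Fin N) : a i = 0 :=
      (Finset.sum_eq_zero_iff_of_nonneg fun i _ => ha i).1 hA.symm i (Finset.mem_univ i)
    obtain ⟨O, h2, h3, h4, -⟩ :=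
      exists_candidates_near_point hx hN hK h0 hn hKn ⟨0, by omega⟩
    exact ⟨_, O, h2, h3, h4, fun v _ => by simp [hz]⟩
  set A := ∑ i, a i with hAdef
  set c := A⁻¹ • ∑ i, a i • x i with hcdef
  have hc : ∑ i, a i • (x i - c) = 0 := by
    simp only [smul_sub, Finset.sum_sub_distrib, ← Finset.sum_smul]
    rw [← hAdef, hcdef, smul_smul, mul_inv_cancel₀ hA.ne', one_smul, sub_self]
  set V := ∑ i, a i * ‖x i - c‖ ^ 2 with hV
  have hV0 : 0 ≤ V := Finset.sum_nonneg fun i _ => mul_nonneg (ha i) (sq_nonneg _)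
  have hVμ : V ≤ ∑ i, a i * ‖x i - μ‖ ^ 2 := by
    rw [sum_mul_norm_sub_sq hc μ]
    have : 0 ≤ A * ‖μ - c‖ ^ 2 := by positivity
    linarith
  have hgoal : (1 + ε) * V ≤ (1 + ε) * ∑ i, a i * ‖x i - μ‖ ^ 2 := by gcongr
  rcases exists_close_or_exists_pair ha hA hc h0 h1 with ⟨i, hi⟩ | ⟨i, j, hij, hi, hj⟩
  · obtain ⟨O, h2, h3, h4, h5⟩ := exists_candidates_near_point hx hN hK h0 hn hKn i
    refine ⟨x i, O, h2, h3, h4, fun v hv => le_trans ?_ hgoal⟩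
    calc ∑ j with x j ≠ x i, a j * ‖x j - v‖ ^ 2
        ≤ ∑ j with x j ≠ x i, (1 + ε / 64) ^ 2 * (a j * ‖x j - x i‖ ^ 2) := by
          refine Finset.sum_le_sum fun j hj => ?_
          have := h5 v hv j (fun h => (Finset.mem_filter.1 hj).2 (by rw [h]))
          nlinarith [mul_le_mul_of_nonneg_left this (ha j)]
      _ ≤ ∑ j, (1 + ε / 64) ^ 2 * (a j * ‖x j - x i‖ ^ 2) :=
          Finset.sum_le_sum_of_subset_of_nonneg (Finset.filter_subset _ _) fun j _ _ =>
            mul_nonneg (sq_nonneg _) (mul_nonneg (ha j) (sq_nonneg _))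
      _ = (1 + ε / 64) ^ 2 * (V + A * ‖x i - c‖ ^ 2) := by
          rw [← Finset.mul_sum, sum_mul_norm_sub_sq hc (x i)]
      _ ≤ (1 + ε / 64) ^ 2 * (V + ε / 60 * V) := by gcongr
      _ = ((1 + ε / 64) ^ 2 * (1 + ε / 60)) * V := by ring
      _ ≤ (1 + ε) * V := by
          -- For `0 < ε < 1` the product `(1 + ε / 64) ^ 2 * (1 + ε / 60)` stays below `1 + ε`.
          gcongr
          nlinarith [mul_pos h0 h0, mul_pos h0 (mul_pos h0 h0), mul_pos h0 (sub_pos.2 h1),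
            mul_pos (mul_pos h0 h0) (sub_pos.2 h1)]
  · obtain ⟨O, h3, h4, h5⟩ := exists_candidates_near_centroid ha hA hc hK h0 hn hKn
      (fun h => hij (hx h)) hi hj
    -- Here the bound holds with no point left out, so `z` may be any element of `O`.
    obtain ⟨z, hz⟩ : O.Nonempty := Finset.card_pos.1 (by omega)
    refine ⟨z, O, hz, h3, h4, fun v hv => le_trans ?_ hgoal⟩
    calc ∑ j with x j ≠ z, a j * ‖x j - v‖ ^ 2 ≤ ∑ j, a j * ‖x j - v‖ ^ 2 :=
          Finset.sum_le_sum_of_subset_of_nonneg (Finset.filter_subset _ _) fun j _ _ =>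
            mul_nonneg (ha j) (sq_nonneg _)
      _ = V + A * ‖v - c‖ ^ 2 := sum_mul_norm_sub_sq hc v
      _ ≤ V + ε * V := add_le_add_right (h5 v hv) V
      _ = (1 + ε) * V := by ring

/-! ### Choosing different means for all clusters -/

/-- Distinct representatives of `K` sets of size at least `K` that hit a given point of each. -/
theorem exists_injective_hitting {α : Type*} [DecidableEq α] {K : ℕ} {O : Fin K → Finset α}
    {z : Fin K → α} (hz : ∀ k, z k ∈ O k) (hO : ∀ k, K ≤ (O k).card) :
    ∃ v : Fin K → α, Function.Injective v ∧ (∀ k, v k ∈ O k) ∧ ∀ k, ∃ k', v k' = z k := by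
  classical
  -- `P k` selects the first index at which a value of `z` appears. Such an index is forced to take
  -- that value; every other index keeps all of `O k`. In Hall's condition, `z` is injective on
  -- first indices, and a single other index already contributes at least `K` elements.
  let P : Fin K → Prop := fun k => ∀ k' < k, z k' ≠ z k
  let t : Fin K → Finset α := fun k => if P k then {z k} else O k
  have hall : ∀ s : Finset (Fin K), s.card ≤ (s.biUnion t).card := by
    intro s
    by_cases hs : ∀ k ∈ s, P k
    · have hinj : Set.InjOn z s := by
        intro k hk k' hk' he
        rcases lt_trichotomy k k' with h | h | h
        · exact absurd he (hs k' hk' k h)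
        · exact h
        · exact absurd he.symm (hs k hk k' h)
      rw [← Finset.card_image_of_injOn hinj]
      refine Finset.card_le_card fun y hy => ?_
      obtain ⟨k, hk, rfl⟩ := Finset.mem_image.1 hy
      exact Finset.mem_biUnion.2 ⟨k, hk, by simp [t, hs k hk]⟩
    · push Not at hs
      obtain ⟨k, hk, hP⟩ := hs
      calc s.card ≤ K := by simpa using s.card_le_univ
        _ ≤ (O k).card := hO k
        _ = (t k).card := by simp [t, hP]
        _ ≤ _ := Finset.card_le_card (Finset.subset_biUnion_of_mem t hk)
  obtain ⟨v, hv, hvt⟩ := (Finset.all_card_le_biUnion_card_iff_exists_injective t).1 hall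
  refine ⟨v, hv, fun k => ?_, fun k => ?_⟩
  · have := hvt k
    by_cases hP : P k
    · simp only [t, if_pos hP, Finset.mem_singleton] at this
      rw [this]; exact hz k
    · simpa only [t, if_neg hP] using this
  · obtain ⟨k', hk', hmin⟩ := WellFounded.has_min (wellFounded_lt (α := Fin K))
      {k' | z k' = z k} ⟨k, rfl⟩
    have hk' : z k' = z k := hk'
    have hP : P k' := fun k'' hlt he => hmin k'' (he.trans hk') hlt
    have := hvt k'
    simp only [t, if_pos hP, Finset.mem_singleton] at this
    exact ⟨k', this.trans hk'⟩

/-- The cost of `K` different means is at most that of any memberships, without the points that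
are themselves among the means. -/
theorem setCost_image_le {D N K : ℕ} (x : Fin N → EuclideanSpace ℝ (Fin D)) (w : Fin N → ℕ)
    {m : ℝ} (hm : 1 < m) {r : Fin N → Fin K → ℝ} (hr : IsMembership r)
    {v : Fin K → EuclideanSpace ℝ (Fin D)} (hv : Function.Injective v)
    {T : Finset (EuclideanSpace ℝ (Fin D))} (hT : ∀ y, y ∈ T ↔ ∃ k, v k = y) :
    setCost x w m T ≤ ∑ k, ∑ i with x i ∉ T, (w i * r i k ^ m) * ‖x i - v k‖ ^ 2 := by
  classical
  let e : Fin K ≃ T := Equiv.ofBijective (fun k => ⟨v k, (hT _).2 ⟨k, rfl⟩⟩)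
    ⟨fun k k' h => hv (Subtype.ext_iff.1 h), fun y => by
      obtain ⟨k, hk⟩ := (hT y).1 y.2
      exact ⟨k, Subtype.ext hk⟩⟩
  have he (k : Fin K) : (e k : EuclideanSpace ℝ (Fin D)) = v k := rfl
  -- A point that is one of the means belongs entirely to itself and costs nothing; all other points
  -- keep their memberships, carried over along `k ↦ v k`.
  let r' : Fin N → T → ℝ := fun i t =>
    if x i ∈ T then (if (t : EuclideanSpace ℝ (Fin D)) = x i then 1 else 0) else r i (e.symm t)
  have hr' : IsMembership r' := by
    refine isMembership_of_nonneg (fun i t => ?_) fun i => ?_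
    · simp only [r']
      split_ifs
      · exact zero_le_one
      · exact le_rfl
      · exact (hr.1 i _).1
    · by_cases hi : x i ∈ T
      · simp only [r', if_pos hi]
        rw [Finset.sum_eq_single ⟨x i, hi⟩]
        · simp
        · intro t _ ht
          exact if_neg fun h => ht (Subtype.ext h)
        · simp
      · simp only [r', if_neg hi]
        rw [Equiv.sum_comp e.symm (r i), hr.2 i]
  refine (setCost_le_cost x w m T hr').trans (le_of_eq ?_)
  rw [cost, Finset.sum_comm, ← Finset.sum_filter_add_sum_filter_not Finset.univ (fun i => x i ∉ T)]
  have hzero : ∑ i with ¬ x i ∉ T, (w i : ℝ) * ∑ t : T, r' i t ^ m * ‖x i - t‖ ^ 2 = 0 := by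
    refine Finset.sum_eq_zero fun i hi => ?_
    have hi : x i ∈ T := not_not.1 (Finset.mem_filter.1 hi).2
    rw [Finset.sum_eq_zero, mul_zero]
    intro t _
    by_cases ht : (t : EuclideanSpace ℝ (Fin D)) = x i
    · simp [ht]
    · simp [r', hi, ht, Real.zero_rpow (by linarith : m ≠ 0)]
  rw [hzero, add_zero]
  refine Finset.sum_congr rfl fun i hi => ?_
  have hi : x i ∉ T := (Finset.mem_filter.1 hi).2
  rw [Finset.mul_sum, ← Equiv.sum_comp e]
  refine Finset.sum_congr rfl fun k _ => ?_
  simp only [r', if_neg hi, Equiv.symm_apply_apply, he, mul_assoc]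

/-- Some `K` different candidates are at most `1 + ε` times as costly as given means. -/
theorem exists_candidates_setCost_le {D N K n : ℕ} {x : Fin N → EuclideanSpace ℝ (Fin D)}
    (w : Fin N → ℕ) {m : ℝ} (hm : 1 < m)
    (hx : Function.Injective x) (hN : 2 ≤ N) (hK : 1 ≤ K) {ε : ℝ} (h0 : 0 < ε) (h1 : ε < 1)
    (hn : 64 * (K : ℝ) ≤ n * ε) (hKn : K ≤ n) (μ : Fin K → EuclideanSpace ℝ (Fin D))
    {r : Fin N → Fin K → ℝ} (hr : IsMembership r) :
    ∃ T : Finset (EuclideanSpace ℝ (Fin D)), T.card = K ∧ (∀ v ∈ T, v ∈ candidates x n) ∧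
      setCost x w m T ≤ (1 + ε) * cost x w m μ r := by
  classical
  have ha (k : Fin K) (i : Fin N) : 0 ≤ (w i : ℝ) * r i k ^ m :=
    mul_nonneg (Nat.cast_nonneg _) (Real.rpow_nonneg (hr.1 i k).1 _)
  choose z O hz hO hcand hle using fun k =>
    exists_candidates_for_cluster hx hN hK h0 h1 hn hKn (ha k) (μ k)
  obtain ⟨v, hv, hvO, hvz⟩ := exists_injective_hitting hz hO
  have hT (y : EuclideanSpace ℝ (Fin D)) : y ∈ Finset.univ.image v ↔ ∃ k, v k = y := by simp
  refine ⟨Finset.univ.image v, ?_, ?_, ?_⟩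
  · rw [Finset.card_image_of_injective _ hv, Finset.card_univ, Fintype.card_fin]
  · intro y hy
    obtain ⟨k, rfl⟩ := (hT y).1 hy
    exact hcand k _ (hvO k)
  · refine (setCost_image_le x w hm hr hv hT).trans ?_
    have hcost : cost x w m μ r = ∑ k, ∑ i, (w i * r i k ^ m) * ‖x i - μ k‖ ^ 2 := by
      rw [cost, Finset.sum_comm]
      refine Finset.sum_congr rfl fun i _ => ?_
      rw [Finset.mul_sum]
      exact Finset.sum_congr rfl fun k _ => by ring
    rw [hcost, Finset.mul_sum]
    refine Finset.sum_le_sum fun k _ => le_trans ?_ (hle k (v k) (hvO k))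
    refine Finset.sum_le_sum_of_subset_of_nonneg (fun i hi => ?_) fun i _ _ =>
      mul_nonneg (ha k i) (sq_nonneg _)
    rw [Finset.mem_filter] at hi ⊢
    -- The point left out of the bound for cluster `k` is `z k`, and `z k` is one of the chosen
    -- means.
    refine ⟨hi.1, fun h => hi.2 ?_⟩
    rw [h]
    exact (hT _).2 (hvz k)

/-! ### Running time -/

theorem sqDist_time {D : ℕ} (p q : EuclideanSpace ℝ (Fin D)) : (sqDist p q).time = 1 + D * 4 := by
  rw [sqDist, loop_time_eq (τ := fun _ => 3) (fun _ _ _ => rfl)]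
  simp

theorem sequences_time_le {α : Type} (l : List α) (hl : l ≠ []) (k : ℕ) :
    (sequences l k).time ≤ 1 + 6 * k * l.length ^ k := by
  induction k with
  | zero => simp [sequences]
  | succ k ih =>
    have hpos : 1 ≤ l.length := List.length_pos_iff.2 hl
    have hp : 1 ≤ l.length ^ k := Nat.one_le_pow _ _ hpos
    have hbody (acc : List (List α)) : ∀ a ∈ l, (loop (fun acc t => do
        let s ← op (a :: t)
        op (s :: acc)) acc (sequences l k).val).time ≤ 1 + l.length ^ k * 3 := fun a _ => by
      have := loop_time_le (t := 2) (l := (sequences l k).val) (body := fun acc t => do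
        let s ← op (a :: t)
        op (s :: acc)) (fun _ _ _ => le_rfl) acc
      rwa [length_sequences] at this
    have := loop_time_le hbody []
    rw [sequences, Timed.bind_time]
    have h1 : l.length ^ k ≤ l.length ^ (k + 1) := Nat.pow_le_pow_right hpos (Nat.le_succ k)
    have h2 : k * l.length ^ k ≤ k * l.length ^ (k + 1) := Nat.mul_le_mul_left _ h1
    have h3 : l.length ≤ l.length ^ (k + 1) := by
      rw [pow_succ]; exact Nat.le_mul_of_pos_left _ hp
    have h4 : l.length * (1 + l.length ^ k * 3 + 1) = 2 * l.length + 3 * l.length ^ (k + 1) := by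
      ring
    have h5 : 6 * k * l.length ^ k = 6 * (k * l.length ^ k) := by ring
    have h6 : 6 * (k + 1) * l.length ^ (k + 1) =
      6 * (k * l.length ^ (k + 1)) + 6 * l.length ^ (k + 1) := by ring
    omega

theorem sampleMean_time {D N : ℕ} (x : Fin N → EuclideanSpace ℝ (Fin D)) (n : ℕ)
    (S : List (Fin N)) : (sampleMean x n S).time = 1 + D * (S.length * 3 + 3) := by
  have (i : Fin D) : (loop (fun acc j => do
      let y ← op (x j i)
      op (acc + y)) (0 : ℝ) S).time = 1 + S.length * 3 := by
    rw [loop_time_eq (τ := fun _ => 2) (fun _ _ _ => rfl)]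
    simp
  simp only [sampleMean, tabulate, Timed.bind_time, this, op_time, Finset.sum_const,
    Finset.card_univ, Fintype.card_fin, smul_eq_mul]
  ring

theorem meansList_time_le {D N : ℕ} (x : Fin N → EuclideanSpace ℝ (Fin D)) (n : ℕ)
    (hN : 1 ≤ N) : (meansList x n).time ≤
      2 + 6 * n * N ^ n + N ^ n * (3 + D * (n * 3 + 3)) := by
  rw [meansList, Timed.bind_time]
  have h1 := sequences_time_le (List.finRange N) (by
    rw [← List.length_pos_iff]; simpa using Nat.pos_of_ne_zero (by omega)) n
  have h2 := loop_time_le (t := 2 + D * (n * 3 + 3)) (body := fun acc S => do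
    let v ← sampleMean x n S
    op (v :: acc)) (l := (sequences (List.finRange N) n).val) (fun _ S hS => by
      rw [mem_sequences] at hS
      simp only [Timed.bind_time, sampleMean_time, op_time, hS.1]
      omega) []
  rw [length_sequences] at h2
  simp only [List.length_finRange] at h1 h2
  rw [show 2 + D * (n * 3 + 3) + 1 = 3 + D * (n * 3 + 3) by ring] at h2
  omega

theorem notIn_time {D : ℕ} (v : EuclideanSpace ℝ (Fin D)) (l : List (EuclideanSpace ℝ (Fin D))) :
    (notIn v l).time = 1 + l.length * (4 + D * 4) := by
  rw [notIn, loop_time_eq (τ := fun _ => 3 + D * 4)]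
  · simp
    left
    ring
  · intro _ _ _
    simp [sqDist_time]
    ring

theorem distinct_time_le {D : ℕ} (l : List (EuclideanSpace ℝ (Fin D))) :
    (distinct l).time ≤ 1 + l.length * (2 + l.length * (4 + D * 4)) := by
  induction l with
  | nil => simp [distinct]
  | cons v l ih =>
    simp only [distinct, Timed.bind_time, op_time, List.length_cons, notIn_time]
    nlinarith [Nat.zero_le D, Nat.zero_le l.length, mul_nonneg (Nat.zero_le D) (Nat.zero_le l.length)]

theorem pointCost_time_le {D : ℕ} (m : ℝ) (l : List (EuclideanSpace ℝ (Fin D)))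
    (y : EuclideanSpace ℝ (Fin D)) : (pointCost m l y).time ≤ 4 + l.length * (6 + D * 4) := by
  have hloop := loop_time_le (t := 5 + D * 4) (body := fun (st : ℝ × Bool) v => do
    let d ← sqDist y v
    let z ← op (decide (d = 0))
    if z then op (st.1, true)
    else do
      let p ← op (d ^ (1 / (1 - m)))
      let s ← op (st.1 + p)
      op (s, st.2)) (l := l) (fun b a _ => by
        simp only [Timed.bind_time, op_time, sqDist_time]
        split_ifs
        · rw [op_time]; omega
        · change 1 + D * 4 + (1 + (1 + (1 + 1))) ≤ 5 + D * 4; omega) (0, false)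
  have hlast (st : ℝ × Bool) : (if st.2 then op 0 else op (st.1 ^ (1 - m)) : Timed ℝ).time = 1 := by
    split_ifs <;> rfl
  rw [show 5 + D * 4 + 1 = 6 + D * 4 by ring] at hloop
  rw [pointCost]
  simp only [Timed.bind_time, op_time, op_val, hlast] at hloop ⊢
  omega

theorem evalCost_time_le {D N : ℕ} (x : Fin N → EuclideanSpace ℝ (Fin D)) (w : Fin N → ℕ)
    (m : ℝ) (l : List (EuclideanSpace ℝ (Fin D))) :
    (evalCost x w m l).time ≤ 1 + N * (8 + l.length * (6 + D * 4)) := by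
  rw [evalCost]
  refine (loop_time_le (t := 7 + l.length * (6 + D * 4)) (fun _ i _ => ?_) _).trans ?_
  · simp only [Timed.bind_time, op_time]
    have := pointCost_time_le m l (x i)
    omega
  · simp only [List.length_finRange]
    apply le_of_eq
    ring

theorem evalCost_time_eq {D N : ℕ} (x : Fin N → EuclideanSpace ℝ (Fin D)) (w w' : Fin N → ℕ)
    (m : ℝ) (l : List (EuclideanSpace ℝ (Fin D))) :
    (evalCost x w m l).time = (evalCost x w' m l).time := by
  rw [evalCost, evalCost, loop_time_eq (τ := fun i => (pointCost m l (x i)).time + 3),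
    loop_time_eq (τ := fun i => (pointCost m l (x i)).time + 3)] <;>
  exact fun _ _ _ => rfl

/-- The weights change only the computed numbers, and both outcomes of the cost comparison take
equally long. The weight `0` serves as a common reference. -/
theorem searchStep_time {D N : ℕ} (x : Fin N → EuclideanSpace ℝ (Fin D))
    (w : Fin N → ℕ) (m : ℝ) (best : Option (List (EuclideanSpace ℝ (Fin D)) × ℝ))
    (l : List (EuclideanSpace ℝ (Fin D))) :
    (searchStep x w m best l).time =
      (distinct l).time + if (distinct l).val then (evalCost x 0 m l).time + 2 else 1 := by
  rw [searchStep, Timed.bind_time, evalCost_time_eq x 0 w]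
  split_ifs <;> rfl

theorem derandomizedSampling_time_eq {D N : ℕ} (x : Fin N → EuclideanSpace ℝ (Fin D))
    (w w' : Fin N → ℕ) (m : ℝ) (K : ℕ) (ε : ℝ) :
    (derandomizedSampling x w m K ε).time = (derandomizedSampling x w' m K ε).time := by
  rw [derandomizedSampling_time, derandomizedSampling_time,
    loop_time_eq fun b l _ => searchStep_time x w m b l,
    loop_time_eq fun b l _ => searchStep_time x w' m b l]

theorem searchStep_time_le {D N : ℕ} (x : Fin N → EuclideanSpace ℝ (Fin D))
    (w : Fin N → ℕ) (m : ℝ) (best : Option (List (EuclideanSpace ℝ (Fin D)) × ℝ))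
    (l : List (EuclideanSpace ℝ (Fin D))) :
    (searchStep x w m best l).time ≤
      4 + l.length * (2 + l.length * (4 + D * 4)) + N * (8 + l.length * (6 + D * 4)) := by
  rw [searchStep_time]
  have h1 := distinct_time_le l
  have h2 := evalCost_time_le x 0 m l
  split_ifs <;> omega

/-- Rounding up adds less than one, and `1 ≤ K / ε`; hence the constant 65. -/
theorem sampleSize_bounds {K : ℕ} {ε : ℝ} (hK : 1 ≤ K) (h0 : 0 < ε) (h1 : ε < 1) :
    64 * (K : ℝ) ≤ sampleSize K ε * ε ∧ (sampleSize K ε : ℝ) ≤ 65 * K / ε ∧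
      64 * K ≤ sampleSize K ε := by
  have hK' : (1 : ℝ) ≤ K := by exact_mod_cast hK
  have h2 : 64 * (K : ℝ) / ε ≤ sampleSize K ε := Nat.le_ceil _
  have h3 : (sampleSize K ε : ℝ) < 64 * (K : ℝ) / ε + 1 := Nat.ceil_lt_add_one (by positivity)
  refine ⟨by rwa [div_le_iff₀ h0] at h2, ?_, ?_⟩
  · have : 1 ≤ (K : ℝ) / ε := by rw [le_div_iff₀ h0]; linarith
    rw [mul_div_assoc] at h3 ⊢
    linarith
  · have : 64 * (K : ℝ) ≤ 64 * (K : ℝ) / ε := by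
      rw [le_div_iff₀ h0]; nlinarith
    exact_mod_cast this.trans h2

theorem derandomizedSampling_time_le {D N : ℕ} (x : Fin N → EuclideanSpace ℝ (Fin D))
    (w : Fin N → ℕ) (m : ℝ) {K : ℕ} {ε : ℝ} (hN : 2 ≤ N) (hD : 1 ≤ D) (hK : 1 ≤ K)
    (hKn : 64 * K ≤ sampleSize K ε) :
    (derandomizedSampling x w m K ε).time ≤ D * N ^ (6 * (sampleSize K ε * K)) := by
  rw [derandomizedSampling_time]
  set n := sampleSize K ε with hn
  have hmeans := meansList_time_le x n (by omega)
  have hne : (meansList x n).val ≠ [] := by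
    rw [← List.length_pos_iff, length_meansList]; positivity
  have hseq := sequences_time_le (meansList x n).val hne K
  have hloop := loop_time_le
    (t := 4 + K * (2 + K * (4 + D * 4)) + N * (8 + K * (6 + D * 4)))
    (body := searchStep x w m) (l := (sequences (meansList x n).val K).val) (fun b l hl => by
      rw [mem_sequences] at hl
      have := searchStep_time_le x w m b l
      rwa [hl.1] at this) none
  rw [length_sequences] at hloop
  rw [length_meansList] at hseq hloop
  rw [← pow_mul] at hseq hloop
  -- `Q` counts the enumerated choices and also dominates `N`, `K`, `n` and `N ^ n`. Every stage is
  -- then bounded by a constant times `D * Q ^ 3`, and `200 ≤ Q` absorbs the constants into further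
  -- powers of `Q`.
  set Q := N ^ (n * K) with hQ
  have hpos : 0 < N := by omega
  have hnK : n ≤ n * K := Nat.le_mul_of_pos_right _ hK
  have hQ1 : N ^ n ≤ Q := Nat.pow_le_pow_right hpos hnK
  have hnQ : n ≤ N ^ n := (Nat.lt_pow_self (by omega)).le
  have hKQ : K ≤ Q := by omega
  have hNQ : N ≤ Q := by
    calc N = N ^ 1 := (pow_one N).symm
      _ ≤ Q := Nat.pow_le_pow_right hpos (by nlinarith)
  have h200 : 200 ≤ Q := by
    calc 200 ≤ 2 ^ 64 := by norm_num
      _ ≤ N ^ 64 := Nat.pow_le_pow_left hN _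
      _ ≤ Q := Nat.pow_le_pow_right hpos (by nlinarith)
  have hQ1' : 1 ≤ Q := by omega
  have hP : N ^ (6 * (n * K)) = Q ^ 6 := by rw [hQ, ← pow_mul]; ring_nf
  rw [hP]
  have hDQ : 1 ≤ D * Q := Nat.one_le_iff_ne_zero.2 (by positivity)
  have hm2 : (meansList x n).time ≤ 20 * D * Q ^ 2 := by
    have a1 : 6 * n * N ^ n ≤ 6 * Q ^ 2 := by
      calc 6 * n * N ^ n ≤ 6 * Q * Q := by gcongr; omega
        _ = 6 * Q ^ 2 := by ring
    have a2 : N ^ n * (3 + D * (n * 3 + 3)) ≤ Q * (D * Q * 7) := by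
      gcongr
      have : D * (n * 3 + 3) ≤ D * (Q * 6) := by gcongr; omega
      have : D * (Q * 6) = D * Q * 6 := by ring
      have : 200 ≤ D * Q := h200.trans (Nat.le_mul_of_pos_left _ hD)
      omega
    have a3 : Q * (D * Q * 7) = 7 * (D * Q ^ 2) := by ring
    have a4 : Q ^ 2 ≤ D * Q ^ 2 := Nat.le_mul_of_pos_left _ hD
    have a5 : 20 * D * Q ^ 2 = 20 * (D * Q ^ 2) := by ring
    have a6 : 1 ≤ Q ^ 2 := Nat.one_le_pow _ _ hQ1'
    omega
  have hs2 : (sequences (meansList x n).val K).time ≤ 7 * D * Q ^ 2 := by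
    have a1 : 6 * K * Q ≤ 6 * Q * Q := by gcongr
    have a2 : 6 * Q * Q = 6 * Q ^ 2 := by ring
    have a4 : Q ^ 2 ≤ D * Q ^ 2 := Nat.le_mul_of_pos_left _ hD
    have a5 : 7 * D * Q ^ 2 = 7 * (D * Q ^ 2) := by ring
    have a6 : 1 ≤ Q ^ 2 := Nat.one_le_pow _ _ hQ1'
    omega
  have hl2 : (loop (searchStep x w m) none (sequences (meansList x n).val K).val).time ≤
      40 * D * Q ^ 3 := by
    refine hloop.trans ?_
    calc 1 + Q * (4 + K * (2 + K * (4 + D * 4)) + N * (8 + K * (6 + D * 4)) + 1)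
        ≤ D * Q ^ 3 + Q * (4 * (D * Q ^ 2) + Q * (2 * (D * Q) + Q * (4 * D + D * 4)) +
          Q * (8 * (D * Q) + Q * (6 * D + D * 4)) + D * Q ^ 2) := by
          have b1 : 1 ≤ D * Q ^ 3 := Nat.one_le_iff_ne_zero.2 (by positivity)
          have b2 : 1 ≤ D * Q ^ 2 := Nat.one_le_iff_ne_zero.2 (by positivity)
          gcongr <;> omega
      _ = 34 * D * Q ^ 3 := by ring
      _ ≤ 40 * D * Q ^ 3 := by gcongr; norm_num
  have h3 : 3 * (n + 1) ≤ 3 * D * Q ^ 2 + 3 := by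
    have : n ≤ D * Q ^ 2 := by
      calc n ≤ 1 * Q := by omega
        _ ≤ D * Q ^ 2 := by gcongr; exact Nat.le_self_pow (by norm_num) _
    nlinarith
  have hq23 : D * Q ^ 2 ≤ D * Q ^ 3 := by gcongr; norm_num
  have hq1 : 1 ≤ D * Q ^ 3 := Nat.one_le_iff_ne_zero.2 (by positivity)
  have hfin : 200 * (D * Q ^ 3) ≤ D * Q ^ 6 := by
    calc 200 * (D * Q ^ 3) ≤ Q * (D * Q ^ 3) := by gcongr
      _ = D * Q ^ 4 := by ring
      _ ≤ D * Q ^ 6 := by gcongr; norm_num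
  simp only [mul_assoc] at hm2 hs2 hl2 h3
  omega

/-- The running time is at most `D * N ^ (390 * K ^ 2 / ε)`. -/
theorem derandomizedSampling_time_le_rpow {D N : ℕ} (x : Fin N → EuclideanSpace ℝ (Fin D))
    (w : Fin N → ℕ) (m : ℝ) {K : ℕ} {ε : ℝ} (hN : 2 ≤ N) (hD : 1 ≤ D) (hK : 1 ≤ K)
    (h0 : 0 < ε) (h1 : ε < 1) :
    ((derandomizedSampling x w m K ε).time : ℝ) ≤
      (D : ℝ) * (N : ℝ) ^ (390 * (K : ℝ) ^ 2 / ε) := by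
  obtain ⟨-, h2, h3⟩ := sampleSize_bounds hK h0 h1
  have h4 := derandomizedSampling_time_le x w m hN hD hK h3
  have hN' : (1 : ℝ) ≤ N := by exact_mod_cast (by omega : 1 ≤ N)
  calc ((derandomizedSampling x w m K ε).time : ℝ)
      ≤ (D : ℝ) * (N : ℝ) ^ (6 * (sampleSize K ε * K)) := by exact_mod_cast h4
    _ ≤ _ := by
      rw [← Real.rpow_natCast]
      refine mul_le_mul_of_nonneg_left (Real.rpow_le_rpow_of_exponent_le hN' ?_)
        (Nat.cast_nonneg _)
      · push_cast
        calc 6 * ((sampleSize K ε : ℝ) * K) ≤ 6 * (65 * K / ε * K) := by gcongr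
          _ = 390 * (K : ℝ) ^ 2 / ε := by ring

end FuzzyKMeans
-- The main theorem
theorem mainTheorem5 :
    ∃ C : ℝ, 0 < C ∧
      ∀ (D N K : ℕ) (m ε : ℝ) (x : Fin N → EuclideanSpace ℝ (Fin D)) (w : Fin N → ℕ),
        2 ≤ N → 1 ≤ K → 1 < m → 0 < ε → ε < 1 → Function.Injective x →
          (∃ (l : List (EuclideanSpace ℝ (Fin D))) (M : Finset (EuclideanSpace ℝ (Fin D))),
            (FuzzyKMeans.derandomizedSampling x w m K ε).val = some l ∧
            l.Nodup ∧ (∀ v, v ∈ l ↔ v ∈ M) ∧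
            M.card = K ∧
            (M : Set (EuclideanSpace ℝ (Fin D))) ⊆
              FuzzyKMeans.candidates x (FuzzyKMeans.sampleSize K ε) ∧
            (∀ T : Finset (EuclideanSpace ℝ (Fin D)), T.card = K →
              (T : Set (EuclideanSpace ℝ (Fin D))) ⊆
                FuzzyKMeans.candidates x (FuzzyKMeans.sampleSize K ε) →
              FuzzyKMeans.setCost x w m M ≤ FuzzyKMeans.setCost x w m T) ∧
            FuzzyKMeans.setCost x w m M ≤ (1 + ε) * FuzzyKMeans.optCost x w m K) ∧
          ((FuzzyKMeans.derandomizedSampling x w m K ε).time : ℝ) ≤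
            (D : ℝ) * (N : ℝ) ^ (C * (K : ℝ) ^ 2 / ε) ∧
          (∀ w' : Fin N → ℕ,
            (FuzzyKMeans.derandomizedSampling x w' m K ε).time =
              (FuzzyKMeans.derandomizedSampling x w m K ε).time) := by
  classical
  refine ⟨390, by norm_num, fun D N K m ε x w hN hK hm h0 h1 hx => ?_⟩
  -- In dimension zero there is only one point, while `x` lists at least two different ones.
  have hD : 1 ≤ D := by
    by_contra hD
    obtain rfl : D = 0 := by omega
    have h := @hx ⟨0, by omega⟩ ⟨1, by omega⟩ (Subsingleton.elim _ _)
    simp at h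
  refine ⟨?_, FuzzyKMeans.derandomizedSampling_time_le_rpow x w m hN hD hK h0 h1,
    fun w' => FuzzyKMeans.derandomizedSampling_time_eq x w' w m K ε⟩
  obtain ⟨hn, -, hKn'⟩ := FuzzyKMeans.sampleSize_bounds hK h0 h1
  have hKn : K ≤ FuzzyKMeans.sampleSize K ε := by omega
  have hKpos : Nonempty (Fin K) := ⟨⟨0, by omega⟩⟩
  have hunif : FuzzyKMeans.IsMembership fun (_ : Fin N) (_ : Fin K) => (K : ℝ)⁻¹ := by
    refine FuzzyKMeans.isMembership_of_nonneg (fun _ _ => by positivity) fun _ => ?_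
    have : (K : ℝ) ≠ 0 := by positivity
    simp [this]
  have happrox (μ : Fin K → EuclideanSpace ℝ (Fin D)) {r : Fin N → Fin K → ℝ}
      (hr : FuzzyKMeans.IsMembership r) :=
    FuzzyKMeans.exists_candidates_setCost_le w hm hx hN hK h0 h1 hn hKn μ hr
  -- The zero means and uniform memberships are arbitrary: this only shows that `K` different
  -- candidates exist, so the search does not return `none`.
  obtain ⟨T₀, hT₀, hcand₀, -⟩ := happrox 0 hunif
  obtain ⟨l, hl, hnodup, hlen, hcand, hmin⟩ :=
    FuzzyKMeans.exists_derandomizedSampling_val x w m K ε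
      ⟨T₀.toList, T₀.nodup_toList, by simpa using hT₀, by simpa using hcand₀⟩
  have hlM : ∀ v, v ∈ l ↔ v ∈ l.toFinset := fun v => List.mem_toFinset.symm
  have hcard : l.toFinset.card = K := by rw [List.toFinset_card_of_nodup hnodup, hlen]
  have hbest : ∀ T : Finset (EuclideanSpace ℝ (Fin D)), T.card = K →
      (T : Set (EuclideanSpace ℝ (Fin D))) ⊆
        FuzzyKMeans.candidates x (FuzzyKMeans.sampleSize K ε) →
      FuzzyKMeans.setCost x w m l.toFinset ≤ FuzzyKMeans.setCost x w m T := by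
    intro T hT hTc
    rw [← FuzzyKMeans.evalCost_eq_setCost x w hm hnodup hlM (Finset.card_pos.1 (by omega)),
      ← FuzzyKMeans.evalCost_eq_setCost x w hm T.nodup_toList (fun v => Finset.mem_toList)
        (Finset.card_pos.1 (by omega))]
    exact hmin _ T.nodup_toList (by simpa using hT) fun v hv => hTc (by simpa using hv)
  refine ⟨l, l.toFinset, hl, hnodup, hlM, hcard, fun v hv => hcand v (by simpa using hv), hbest, ?_⟩
  -- After division by `1 + ε` it suffices to bound every cost in the infimum from below, so an
  -- optimal solution need not be shown to exist.
  rw [mul_comm, ← div_le_iff₀ (by linarith)]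
  refine le_csInf ⟨_, 0, _, hunif, rfl⟩ ?_
  rintro _ ⟨μ, r, hr, rfl⟩
  obtain ⟨T, hT, hTc, hle⟩ := happrox μ hr
  rw [div_le_iff₀ (by linarith), mul_comm]
  exact (hbest T hT fun v hv => hTc v hv).trans hle
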